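/- Let $\mathbb D=\{z\in\mathbb C:|z|<1\}$, let $0\le s<r<1$ and $\lambda\in\mathbb C$ with $|\lambda|<1$. Let $$V(r,s,\lambda)=\Big\{f'''(r):\ f:\mathbb D\to\mathbb D\text{ analytic},\ f(0)=0,\ f(r)=s,\ f'(r)=\frac sr+\frac{r^2-s^2}{r(1-r^2)}\lambda\Big\}.$$ Put $$A=\frac{6(r^2-s^2)}{r^3(1-r^2)^3},\quad B=s^2\lambda^3-s(1+r^2)\lambda^2+r^2\lambda,\quad C=r(1-|\lambda|^2)(1+r^2-2s\lambda),$$ $$\eta=\frac{r\overline\lambda}{1+r^2-2s\lambda},\qquad t=\frac{r}{|1+r^2-2s\lambda|},\qquad c(\zeta)=\zeta(1-\eta\zeta).$$ Then the following hold. (i) If $t+|\eta|\le\frac12$, then $\partial V(r,s,\lambda)$ is the Jordan curve given by $\partial\mathbb D\ni\zeta\mapsto A(B+C\,c(\zeta))$; that is, this map is continuous and injective on $\partial\mathbb D$ and its image is $\partial V(r,s,\lambda)$. (ii) If $t-|\eta|\ge\frac12$, then $\partial V(r,s,\lambda)$ is the circle parametrized injectively by $$\partial\mathbb D\ni e^{i\theta}\mapsto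 A\Big\{B+\frac{[1+4(t^2-|\eta|^2)]\,t e^{i\theta}-\overline\eta}{4(t^2-|\eta|^2)}\,C\Big\}.$$ (iii) Suppose $t+|\eta|>\frac12$ and $t-|\eta|<\frac12$. For every $\theta\in\mathbb R$ with $|te^{i\theta}-\overline\eta|\ge2(t^2-|\eta|^2)$, the equation $|xe^{i\theta}-\overline\eta|=2(x^2-|\eta|^2)$ has a unique solution $x>|\eta|$; let $t_\theta$ be this solution, and let $t_\theta=t$ for all other $\theta$. Put $$\zeta_\theta=\frac{t_\theta e^{i\theta}-\overline\eta}{2(t_\theta^2-|\eta|^2)},\qquad \kappa=\frac{t^2+|\eta|^2-4(t^2-|\eta|^2)^2}{2t|\eta|},$$ $$\Theta=\{\theta\in(-\pi,\pi]:\cos(\theta+\arg\eta)>\kappa\},\qquad J=\{\zeta_\theta:\theta\in\mathbb R,\ \cos(\theta+\arg\eta)\le\kappa\}.$$ Then $J$ is a nondegenerate proper closed subarc of $\partial\mathbb D$, and $\partial V(r,s,\lambda)$ is the union of the (open, nondegenerate, proper) circular arc parametrized injectively by $$\Theta\ni\theta\mapsto A\Big\{B+\frac{[1+4(t^2-|\eta|^2)]\,t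 e^{i\theta}-\overline\eta}{4(t^2-|\eta|^2)}\,C\Big\}$$ and the simple arc given by $J\ni\zeta\mapsto A(B+C\,c(\zeta))$, this last map being continuous and injective on $J$. -/

import Mathlib

open Complex Metric Set

noncomputable section

namespace ThirdDieudonne

/-- The class `H₀(r, s, lam)` of analytic self-maps `f` of the open unit disk with `f 0 = 0`,
`f r = s` and `f' r = s / r + (r² - s²) / (r (1 - r²)) * lam`. -/
def classH (r s : ℝ) (lam : ℂ) : Set (ℂ → ℂ) :=
  {f | AnalyticOnNhd ℂ f (ball 0 1) ∧ MapsTo f (ball 0 1) (ball 0 1) ∧ f 0 = 0 ∧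
    f (r : ℂ) = (s : ℂ) ∧
    deriv f (r : ℂ) = (s : ℂ) / r + ((r : ℂ) ^ 2 - s ^ 2) / (r * (1 - (r : ℂ) ^ 2)) * lam}

/-- The variability region `V(r, s, lam)` of `f''' r` over `H₀(r, s, lam)`. -/
def region (r s : ℝ) (lam : ℂ) : Set ℂ :=
  (fun f : ℂ → ℂ => iteratedDeriv 3 f (r : ℂ)) '' classH r s lam

/-- `A = 6 (r² - s²) / (r³ (1 - r²)³)`. -/
def coefA (r s : ℝ) : ℝ := 6 * (r ^ 2 - s ^ 2) / (r ^ 3 * (1 - r ^ 2) ^ 3)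

/-- `B = s² lam³ - s (1 + r²) lam² + r² lam`. -/
def coefB (r s : ℝ) (lam : ℂ) : ℂ :=
  (s : ℂ) ^ 2 * lam ^ 3 - s * (1 + (r : ℂ) ^ 2) * lam ^ 2 + (r : ℂ) ^ 2 * lam

/-- `C = r (1 - |lam|²) (1 + r² - 2 s lam)`. -/
def coefC (r s : ℝ) (lam : ℂ) : ℂ :=
  (r : ℂ) * (1 - (‖lam‖ : ℂ) ^ 2) * (1 + (r : ℂ) ^ 2 - 2 * s * lam)

/-- `η = r conj(lam) / (1 + r² - 2 s lam)`. -/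
def eta (r s : ℝ) (lam : ℂ) : ℂ :=
  (r : ℂ) * (starRingEnd ℂ) lam / (1 + (r : ℂ) ^ 2 - 2 * s * lam)

/-- `t = r / |1 + r² - 2 s lam|`. -/
def tPar (r s : ℝ) (lam : ℂ) : ℝ := r / ‖1 + (r : ℂ) ^ 2 - 2 * s * lam‖

/-- The map `ζ ↦ A (B + C c(ζ))` with `c(ζ) = ζ (1 - η ζ)`. -/
def curve (r s : ℝ) (lam : ℂ) (ζ : ℂ) : ℂ :=
  coefA r s * (coefB r s lam + coefC r s lam * (ζ * (1 - eta r s lam * ζ)))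

/-- The map `ω ↦ A (B + C ([1 + 4 (t² - |η|²)] t ω - conj η) / (4 (t² - |η|²)))`, to be used
for `ω = exp (i θ)`. -/
def circleMap (r s : ℝ) (lam : ℂ) (ω : ℂ) : ℂ :=
  coefA r s * (coefB r s lam +
    ((1 + 4 * ((tPar r s lam : ℂ) ^ 2 - (‖eta r s lam‖ : ℂ) ^ 2)) * tPar r s lam * ω
        - (starRingEnd ℂ) (eta r s lam)) /
      (4 * ((tPar r s lam : ℂ) ^ 2 - (‖eta r s lam‖ : ℂ) ^ 2)) * coefC r s lam)

/-- `x` is a solution of `|x exp(iθ) - conj η| = 2 (x² - |η|²)`, `x > |η|`. -/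
def IsSol (η : ℂ) (θ x : ℝ) : Prop :=
  ‖η‖ < x ∧ ‖(x : ℂ) * exp (θ * I) - (starRingEnd ℂ) η‖ = 2 * (x ^ 2 - ‖η‖ ^ 2)

open Classical in
/-- `t_θ`: the solution of the equation in `IsSol` if `|t exp(iθ) - conj η| ≥ 2 (t² - |η|²)`,
and `t` otherwise. -/
def tTheta (t : ℝ) (η : ℂ) (θ : ℝ) : ℝ :=
  if 2 * (t ^ 2 - ‖η‖ ^ 2) ≤ ‖(t : ℂ) * exp (θ * I) - (starRingEnd ℂ) η‖ then
    Classical.epsilon (IsSol η θ)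
  else t

/-- `ζ_θ = (t_θ exp(iθ) - conj η) / (2 (t_θ² - |η|²))`. -/
def zetaTheta (t : ℝ) (η : ℂ) (θ : ℝ) : ℂ :=
  ((tTheta t η θ : ℂ) * exp (θ * I) - (starRingEnd ℂ) η) /
    (2 * ((tTheta t η θ : ℂ) ^ 2 - (‖η‖ : ℂ) ^ 2))

/-- The threshold `(t² + |η|² - 4 (t² - |η|²)²) / (2 t |η|)`. -/
def threshold (t : ℝ) (η : ℂ) : ℝ :=
  (t ^ 2 + ‖η‖ ^ 2 - 4 * (t ^ 2 - ‖η‖ ^ 2) ^ 2) / (2 * t * ‖η‖)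

/-- The set `Θ`. -/
def setTheta (t : ℝ) (η : ℂ) : Set ℝ :=
  {θ | θ ∈ Ioc (-Real.pi) Real.pi ∧ threshold t η < Real.cos (θ + arg η)}

/-- The set `J`. -/
def setJ (t : ℝ) (η : ℂ) : Set ℂ :=
  {ζ | ∃ θ : ℝ, Real.cos (θ + arg η) ≤ threshold t η ∧ ζ = zetaTheta t η θ}

/-- `S` is a (nondegenerate) circle. -/
def IsCircle (S : Set ℂ) : Prop := ∃ (z : ℂ) (R : ℝ), 0 < R ∧ S = sphere z R

/-- `S` is a nondegenerate proper arc, without its end points, of a circle. -/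
def IsOpenCircularArc (S : Set ℂ) : Prop :=
  ∃ (z : ℂ) (R a b : ℝ), 0 < R ∧ a < b ∧ b < a + 2 * Real.pi ∧
    S = (fun θ : ℝ => z + R * exp (θ * I)) '' Ioo a b

/-- `S` is a nondegenerate proper closed subarc of the unit circle. -/
def IsClosedUnitArc (S : Set ℂ) : Prop :=
  ∃ a b : ℝ, a < b ∧ b < a + 2 * Real.pi ∧ S = (fun θ : ℝ => exp (θ * I)) '' Icc a b

end ThirdDieudonne

end

/-! The Schur algorithm removes all constraints on `f`. Write `f = z g`; a Schur step on `g` at `r`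
gives `h` with `h r = lam`, and a Schur step on `h` at `r` gives an arbitrary Schur function `k`.
Differentiating back, `f''' r` is an affine image of `α (1 - η α) + τ β`, where `α = k r`, `β = (1 -
r²) k' r` and `|τ| = t`. By Schwarz-Pick the pairs `(α, β)` are exactly those with `|α| ≤ 1`, `|β| ≤
1 - |α|²` (`exists_isSchur_iff`), so `region` is an affine copy of the union of disks `diskUnion η
t` (`region_eq_image_diskUnion`).

Since `‖η‖ = t ‖lam‖ < t`, this compact set is convex and has exactly one support point in each
direction `e` (`frontier_diskUnion`). There `β = e` may be taken, and `α` maximizes the strictly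
concave function `Re (conj e α (1 - η α)) + t (1 - |α|²)` on the closed disk. The Lagrange condition
is `2 x ζ = e (1 - 2 conj η conj ζ)` with `x ≥ t`, and `x = t` or `|ζ| = 1`; for given `x` it is
solved by `critical η x e`.

If the constraint is inactive (`x = t`), the support point is affine in `e` and runs on a circle; if
it is active, the point is `ζ (1 - η ζ)`. The sign of `|t e - conj η| - 2 (t² - |η|²)` decides
which. As that norm ranges over `[t - |η|, t + |η|]`, comparing `t - |η|` and `t + |η|` with `1/2`
gives the three cases. -/

noncomputable section
namespace ThirdDieudonne
open scoped ComplexConjugate Topology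

/-! ### Schur functions, the Schur algorithm and first jets -/

/-- Schur functions: analytic maps of the unit disk into the closed unit disk. -/
def IsSchur (q : ℂ → ℂ) : Prop :=
  DifferentiableOn ℂ q (ball 0 1) ∧ ∀ z ∈ ball (0 : ℂ) 1, ‖q z‖ ≤ 1

theorem one_add_conj_mul_ne_zero {b w : ℂ} (hb : ‖b‖ < 1) (hw : ‖w‖ ≤ 1) :
    1 + conj b * w ≠ 0 := by
  intro h
  have h1 : conj b * w = -1 := by linear_combination h
  have h2 : ‖b‖ * ‖w‖ = 1 := by
    have := congrArg norm h1
    simpa using this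
  nlinarith [norm_nonneg b, norm_nonneg w]

theorem one_sub_conj_mul_ne_zero {b w : ℂ} (hb : ‖b‖ < 1) (hw : ‖w‖ ≤ 1) :
    1 - conj b * w ≠ 0 := by
  have := one_add_conj_mul_ne_zero (b := -b) (w := w) (by simpa using hb) hw
  simpa [sub_eq_add_neg] using this

theorem sq_norm_one_add_conj_mul_sub (b w : ℂ) :
    ‖1 + conj b * w‖ ^ 2 - ‖b + w‖ ^ 2 = (1 - ‖w‖ ^ 2) * (1 - ‖b‖ ^ 2) := by
  simp only [Complex.sq_norm, Complex.normSq_apply, add_re, add_im, mul_re, mul_im, conj_re,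
    conj_im, one_re, one_im]
  ring

theorem norm_moebius_le_one {b w : ℂ} (hb : ‖b‖ < 1) (hw : ‖w‖ ≤ 1) :
    ‖(b + w) / (1 + conj b * w)‖ ≤ 1 := by
  rw [norm_div, div_le_one (norm_pos_iff.2 (one_add_conj_mul_ne_zero hb hw))]
  have h := sq_norm_one_add_conj_mul_sub b w
  have : 0 ≤ (1 - ‖w‖ ^ 2) * (1 - ‖b‖ ^ 2) :=
    mul_nonneg (by nlinarith [norm_nonneg w]) (by nlinarith [norm_nonneg b])
  exact le_of_sq_le_sq (by linarith) (norm_nonneg _)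

theorem norm_moebius_lt_one {b w : ℂ} (hb : ‖b‖ < 1) (hw : ‖w‖ < 1) :
    ‖(b + w) / (1 + conj b * w)‖ < 1 := by
  rw [norm_div, div_lt_one (norm_pos_iff.2 (one_add_conj_mul_ne_zero hb hw.le))]
  have h := sq_norm_one_add_conj_mul_sub b w
  have : 0 < (1 - ‖w‖ ^ 2) * (1 - ‖b‖ ^ 2) :=
    mul_pos (by nlinarith [norm_nonneg w]) (by nlinarith [norm_nonneg b])
  exact lt_of_pow_lt_pow_left₀ 2 (norm_nonneg _) (by linarith)

theorem differentiableAt_moebius {b z : ℂ} {h : ℂ → ℂ} (hb : ‖b‖ < 1)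
    (hd : DifferentiableAt ℂ h z) (hz : ‖h z‖ ≤ 1) :
    DifferentiableAt ℂ (fun w => (b + h w) / (1 + conj b * h w)) z :=
  (hd.const_add b).div ((hd.const_mul (conj b)).const_add 1) (one_add_conj_mul_ne_zero hb hz)

theorem IsSchur.eq_of_norm_eq_one {q : ℂ → ℂ} (hq : IsSchur q) {p z : ℂ} (hp : ‖p‖ < 1)
    (hqp : ‖q p‖ = 1) (hz : ‖z‖ < 1) : q z = q p := by
  have := Complex.eqOn_of_isPreconnected_of_isMaxOn_norm (c := p)
    (convex_ball (0 : ℂ) 1).isPreconnected isOpen_ball hq.1 (by simpa using hp)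
    (fun w hw => by simpa [hqp] using hq.2 w hw)
  exact this (by simpa using hz)

theorem IsSchur.differentiableAt {q : ℂ → ℂ} (hq : IsSchur q) {z : ℂ} (hz : ‖z‖ < 1) :
    DifferentiableAt ℂ q z :=
  hq.1.differentiableAt (isOpen_ball.mem_nhds (by simpa using hz))

/-- One step of the Schur algorithm at the point `p`. -/
theorem IsSchur.exists_schur_parameter {g : ℂ → ℂ} (hg : IsSchur g) {p : ℂ} (hp : ‖p‖ < 1)
    (hgp : ‖g p‖ < 1) :
    ∃ q, IsSchur q ∧ ∀ z, ‖z‖ < 1 →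
      (g z - g p) * (1 - conj p * z) = q z * (z - p) * (1 - conj (g p) * g z) := by
  set ψ : ℂ → ℂ := fun w => (p + w) / (1 + conj p * w) with hψ
  set φ : ℂ → ℂ := fun z => (-p + z) / (1 + conj (-p) * z) with hφ
  -- Disk automorphisms move `p` and `g p` to `0`; the Schwarz quotient `G w / w`, pulled back by
  -- `φ`, is the required parameter.
  set G : ℂ → ℂ := fun w => (-g p + g (ψ w)) / (1 + conj (-g p) * g (ψ w)) with hG
  have hψ1 : ∀ w, ‖w‖ < 1 → ‖ψ w‖ < 1 := fun w hw => norm_moebius_lt_one hp hw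
  have hφ1 : ∀ w, ‖w‖ < 1 → ‖φ w‖ < 1 := fun w hw =>
    norm_moebius_lt_one (by simpa using hp) hw
  have hφd : DifferentiableOn ℂ φ (ball 0 1) := by
    intro w hw
    exact (differentiableAt_moebius (by simpa using hp) differentiableAt_id
      (by simpa using (mem_ball_zero_iff.1 hw).le)).differentiableWithinAt
  have hGd : DifferentiableOn ℂ G (ball 0 1) := by
    intro w hw
    have hw' : ‖w‖ < 1 := by simpa using hw
    have h1 : DifferentiableAt ℂ ψ w :=
      differentiableAt_moebius hp differentiableAt_id hw'.le
    have h2 : DifferentiableAt ℂ (fun w => g (ψ w)) w :=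
      (hg.differentiableAt (hψ1 w hw')).comp w h1
    exact (differentiableAt_moebius (by simpa using hgp) h2
      (hg.2 _ (by simpa using hψ1 w hw'))).differentiableWithinAt
  have hG0 : G 0 = 0 := by simp [hG, hψ]
  have hGm : MapsTo G (ball 0 1) (closedBall (G 0) 1) := by
    intro w hw
    rw [hG0, mem_closedBall_zero_iff]
    exact norm_moebius_le_one (by simpa using hgp)
      (hg.2 _ (by simpa using hψ1 w (by simpa using hw)))
  have hslope : DifferentiableOn ℂ (dslope G 0) (ball 0 1) :=
    (differentiableOn_dslope (ball_mem_nhds 0 one_pos)).2 hGd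
  refine ⟨fun z => dslope G 0 (φ z), ⟨?_, ?_⟩, ?_⟩
  · exact hslope.comp hφd fun w hw => by simpa using hφ1 w (by simpa using hw)
  · intro z hz
    have := norm_dslope_le_div_of_mapsTo_ball hGd hGm
      (z := φ z) (by simpa using hφ1 z (by simpa using hz))
    simpa using this
  · intro z hz
    have h1 : φ z * dslope G 0 (φ z) = G (φ z) := by
      have := sub_smul_dslope G 0 (φ z)
      simpa [hG0] using this
    have hden : 1 + conj (-p) * z ≠ 0 := one_add_conj_mul_ne_zero (by simpa using hp) hz.le
    have h2 : ψ (φ z) = z := by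
      have hne := one_add_conj_mul_ne_zero hp (hφ1 z hz).le
      have h4 : φ z * (1 + conj (-p) * z) = -p + z := div_mul_cancel₀ _ hden
      simp only [map_neg] at h4
      rw [hψ, div_eq_iff hne]
      linear_combination h4
    have h3 : G (φ z) = (-g p + g z) / (1 + conj (-g p) * g z) := by rw [hG]; simp only [h2]
    have hden2 : 1 + conj (-g p) * g z ≠ 0 :=
      one_add_conj_mul_ne_zero (by simpa using hgp) (hg.2 z (by simpa using hz))
    rw [h3, eq_div_iff hden2] at h1
    have h4 : φ z * (1 + conj (-p) * z) = -p + z := by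
      rw [hφ]; exact div_mul_cancel₀ _ hden
    simp only [map_neg] at h1 h4
    linear_combination (-1 : ℂ) * (1 - conj p * z) * h1 +
      dslope G 0 (φ z) * (1 - conj (g p) * g z) * h4

/-- The inverse of a step of the Schur algorithm. -/
theorem IsSchur.exists_of_schur_parameter {q : ℂ → ℂ} (hq : IsSchur q) {p b : ℂ} (hp : ‖p‖ < 1)
    (hb : ‖b‖ < 1) :
    ∃ g, IsSchur g ∧ g p = b ∧ ∀ z, ‖z‖ < 1 →
      (g z - b) * (1 - conj p * z) = q z * (z - p) * (1 - conj b * g z) := by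
  set φ : ℂ → ℂ := fun z => (-p + z) / (1 + conj (-p) * z) with hφ
  have hp' : ‖-p‖ < 1 := by simpa using hp
  have hφq : ∀ z, ‖z‖ < 1 → ‖φ z * q z‖ < 1 := fun z hz => by
    rw [norm_mul]
    have h1 : ‖φ z‖ < 1 := norm_moebius_lt_one hp' hz
    have h2 := hq.2 z (by simpa using hz)
    nlinarith [norm_nonneg (φ z), norm_nonneg (q z)]
  refine ⟨fun z => (b + φ z * q z) / (1 + conj b * (φ z * q z)), ⟨?_, ?_⟩, ?_, ?_⟩
  · intro z hz
    have hz' : ‖z‖ < 1 := by simpa using hz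
    have h1 : DifferentiableAt ℂ φ z :=
      differentiableAt_moebius hp' differentiableAt_id hz'.le
    have h2 := hq.differentiableAt hz'
    exact (differentiableAt_moebius hb (h1.mul h2) (hφq z hz').le).differentiableWithinAt
  · intro z hz
    exact norm_moebius_le_one hb (hφq z (by simpa using hz)).le
  · simp [hφ]
  · intro z hz
    have hne := one_add_conj_mul_ne_zero hb (hφq z hz).le
    have hden : 1 + conj (-p) * z ≠ 0 := one_add_conj_mul_ne_zero hp' hz.le
    have h4 : φ z * (1 + conj (-p) * z) = -p + z := by
      rw [hφ]; exact div_mul_cancel₀ _ hden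
    simp only [map_neg] at h4
    have h3 : (b + φ z * q z) / (1 + conj b * (φ z * q z)) * (1 + conj b * (φ z * q z)) =
        b + φ z * q z := div_mul_cancel₀ _ hne
    apply mul_right_cancel₀ hne
    simp only
    linear_combination (1 - conj p * z + conj b * q z * (z - p)) * h3 +
      q z * (1 - b * conj b) * h4

/-- Differentiate the relation at `p`: both `g z - b` and `z - p` vanish there, so a single term
survives on each side. -/
theorem IsSchur.deriv_mul_eq {g q : ℂ → ℂ} {p b : ℂ} (hg : IsSchur g) (hq : IsSchur q)
    (hp : ‖p‖ < 1) (hgp : g p = b)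
    (h : ∀ z, ‖z‖ < 1 →
      (g z - b) * (1 - conj p * z) = q z * (z - p) * (1 - conj b * g z)) :
    deriv g p * (1 - conj p * p) = q p * (1 - conj b * b) := by
  have hev : (fun z => (g z - b) * (1 - conj p * z)) =ᶠ[𝓝 p]
      fun z => q z * (z - p) * (1 - conj b * g z) := by
    filter_upwards [isOpen_ball.mem_nhds (show p ∈ ball (0 : ℂ) 1 by simpa using hp)] with z hz
    exact h z (by simpa using hz)
  have dg := (hg.differentiableAt hp).hasDerivAt
  have dq := (hq.differentiableAt hp).hasDerivAt
  have d1 := (dg.sub_const b).mul (((hasDerivAt_id p).const_mul (conj p)).const_sub 1)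
  have d2 := (dq.mul ((hasDerivAt_id p).sub_const p)).mul ((dg.const_mul (conj b)).const_sub 1)
  have := (d1.congr_of_eventuallyEq (f₁ := fun z => q z * (z - p) * (1 - conj b * g z))
    hev.symm).unique d2
  simpa [hgp] using this

/-- The first jets of Schur functions at `p`. -/
theorem exists_isSchur_iff {p α β : ℂ} (hp : ‖p‖ < 1) :
    (∃ q, IsSchur q ∧ q p = α ∧ (1 - conj p * p) * deriv q p = β) ↔
      ‖α‖ ≤ 1 ∧ ‖β‖ ≤ 1 - ‖α‖ ^ 2 := by
  constructor
  · rintro ⟨q, hq, rfl, rfl⟩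
    have hle := hq.2 p (by simpa using hp)
    refine ⟨hle, ?_⟩
    rcases hle.lt_or_eq with hlt | heq
    · obtain ⟨k, hk, hrel⟩ := hq.exists_schur_parameter hp hlt
      have := hq.deriv_mul_eq hk hp rfl hrel
      rw [mul_comm, this, norm_mul, conj_mul']
      have h1 := hk.2 p (by simpa using hp)
      have h2 : ‖(1 : ℂ) - (‖q p‖ : ℂ) ^ 2‖ = 1 - ‖q p‖ ^ 2 := by
        rw [← ofReal_pow, ← ofReal_one, ← ofReal_sub, norm_real, Real.norm_of_nonneg]
        nlinarith [norm_nonneg (q p)]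
      rw [h2]
      exact mul_le_of_le_one_left (by nlinarith [norm_nonneg (q p)]) h1
    -- By the maximum principle `q` is constant, so its derivative is zero.
    · have hc : q =ᶠ[𝓝 p] fun _ => q p := by
        filter_upwards [isOpen_ball.mem_nhds (show p ∈ ball (0 : ℂ) 1 by simpa using hp)] with z hz
        exact hq.eq_of_norm_eq_one hp heq (by simpa using hz)
      rw [hc.deriv_eq]
      simp [heq]
  · rintro ⟨hα, hβ⟩
    rcases hα.lt_or_eq with hlt | heq
    · have hpos : 0 < 1 - ‖α‖ ^ 2 := by nlinarith [norm_nonneg α]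
      have hcast : (1 : ℂ) - conj α * α = ((1 - ‖α‖ ^ 2 : ℝ) : ℂ) := by
        rw [conj_mul']; push_cast; ring
      -- A constant Schur parameter already realizes every admissible jet.
      have hk : IsSchur fun _ => β / ((1 - ‖α‖ ^ 2 : ℝ) : ℂ) := by
        refine ⟨differentiableOn_const _, fun z _ => ?_⟩
        rw [norm_div, norm_real, Real.norm_of_nonneg hpos.le]
        exact (div_le_one hpos).2 hβ
      obtain ⟨q, hq, hqp, hrel⟩ := hk.exists_of_schur_parameter hp hlt
      refine ⟨q, hq, hqp, ?_⟩
      rw [mul_comm, hq.deriv_mul_eq hk hp hqp hrel, hcast]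
      exact div_mul_cancel₀ _ (by exact_mod_cast hpos.ne')
    · refine ⟨fun _ => α, ⟨differentiableOn_const _, fun _ _ => hα⟩, rfl, ?_⟩
      have : ‖β‖ ≤ 0 := by simpa [heq] using hβ
      simp [norm_le_zero_iff.1 this]

/-! ### The third derivative through the Schur parameters -/

/-- Only the linear Taylor term of `G` contributes to order three, with factor `3! = 6`. It reduces
a third derivative to one derivative of an explicit remainder. -/
theorem iteratedDeriv_three_of_eventuallyEq {f G : ℂ → ℂ} {p a b : ℂ} (hG : AnalyticAt ℂ G p)
    (h : f =ᶠ[𝓝 p] fun z => a + b * (z - p) + (z - p) ^ 2 * G z) :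
    iteratedDeriv 3 f p = 6 * deriv G p := by
  rw [h.iteratedDeriv_eq]
  have hs : ∀ᶠ z in 𝓝 p, AnalyticAt ℂ G z := hG.eventually_analyticAt
  have e1 : deriv (fun z => a + b * (z - p) + (z - p) ^ 2 * G z) =ᶠ[𝓝 p]
      fun z => b + 2 * (z - p) * G z + (z - p) ^ 2 * deriv G z := by
    filter_upwards [hs] with z hz
    have d := hz.differentiableAt.hasDerivAt
    have d1 := (hasDerivAt_id z).sub_const p
    have := ((d1.const_mul b).const_add a).add ((d1.pow 2).mul d)
    refine (HasDerivAt.deriv this).trans ?_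
    simp
    ring
  have e2 : deriv (fun z => b + 2 * (z - p) * G z + (z - p) ^ 2 * deriv G z) =ᶠ[𝓝 p]
      fun z => 2 * G z + 4 * (z - p) * deriv G z + (z - p) ^ 2 * deriv (deriv G) z := by
    filter_upwards [hs] with z hz
    have d := hz.differentiableAt.hasDerivAt
    have d' := hz.deriv.differentiableAt.hasDerivAt
    have d1 := (hasDerivAt_id z).sub_const p
    have := (((d1.const_mul 2).mul d).const_add b).add ((d1.pow 2).mul d')
    have h2 := (this.congr_of_eventuallyEq (f₁ := fun z =>
      b + 2 * (z - p) * G z + (z - p) ^ 2 * deriv G z) (Filter.Eventually.of_forall fun w => by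
        simp)).deriv
    rw [h2]
    simp
    ring
  rw [iteratedDeriv_succ', iteratedDeriv_succ', iteratedDeriv_one]
  rw [((e1.deriv).trans e2).deriv_eq]
  have d := hG.differentiableAt.hasDerivAt
  have d' := hG.deriv.differentiableAt.hasDerivAt
  have d'' := hG.deriv.deriv.differentiableAt.hasDerivAt
  have d1 := (hasDerivAt_id p).sub_const p
  have := ((d.const_mul 2).add ((d1.const_mul 4).mul d')).add ((d1.pow 2).mul d'')
  refine (HasDerivAt.deriv this).trans ?_
  simp
  ring

/-- The third derivative in terms of the Schur parameters. -/
theorem iteratedDeriv_three_mul_eq {r s : ℝ} {lam : ℂ} (hs : 0 ≤ s) (hsr : s < r) (hr : r < 1)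
    (hlam : ‖lam‖ < 1) {f g h k : ℂ → ℂ} (hh : IsSchur h) (hk : IsSchur k)
    (hfg : ∀ z, ‖z‖ < 1 → f z = z * g z)
    (hhr : h r = lam)
    (hgh : ∀ z, ‖z‖ < 1 →
      (g z - s / r) * (1 - r * z) = h z * (z - r) * (1 - s / r * g z))
    (hhk : ∀ z, ‖z‖ < 1 →
      (h z - lam) * (1 - r * z) = k z * (z - r) * (1 - conj lam * h z))
    (hD : 1 + (r : ℂ) ^ 2 - 2 * s * lam ≠ 0) :
    iteratedDeriv 3 f r = coefA r s * (coefB r s lam + coefC r s lam *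
      (k r * (1 - eta r s lam * k r) +
        r / (1 + (r : ℂ) ^ 2 - 2 * s * lam) * ((1 - r ^ 2) * deriv k r))) := by
  have hr0 : 0 < r := hs.trans_lt hsr
  have hrn : ‖(r : ℂ)‖ < 1 := by rwa [norm_real, Real.norm_of_nonneg hr0.le]
  have hrc : (r : ℂ) ≠ 0 := by exact_mod_cast hr0.ne'
  have hr2 : (1 : ℂ) - r ^ 2 ≠ 0 := by
    have : (1 : ℝ) - r ^ 2 ≠ 0 := by nlinarith
    exact_mod_cast this
  have han : ‖(s / r : ℂ)‖ < 1 := by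
    rw [norm_div, norm_real, norm_real, Real.norm_of_nonneg hr0.le, Real.norm_of_nonneg hs]
    exact (div_lt_one hr0).2 hsr
  set a : ℂ := s / r with ha
  have hac : conj a = a := by simp [ha]
  -- `H` is the divided difference `(h - lam) / (z - r)` and `G` the second-order Taylor remainder
  -- of `f` at `r`, both solved from the Schur relations so that no division by `z - r` remains.
  set H : ℂ → ℂ := fun z => (1 - conj lam * lam) * k z / ((1 - r * z) + conj lam * ((z - r) * k z))
    with hH
  set G : ℂ → ℂ := fun z => (1 - a ^ 2) *
    ((lam + z * H z) * (1 - r ^ 2) + r ^ 2 * lam - r * lam * a * h z) /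
      ((1 - r ^ 2) * ((1 - r * z) + a * ((z - r) * h z))) with hG
  -- After division by `1 - r z` this is `1 + conj b * w` with `|w| ≤ 1`, because `(z - r) / (1 - r
  -- z)` lies in the disk.
  have hd : ∀ {b z : ℂ} {q : ℂ → ℂ}, IsSchur q → ‖b‖ < 1 → ‖z‖ < 1 →
      (1 - r * z) + conj b * ((z - r) * q z) ≠ 0 := by
    intro b z q hq hb hz
    have h1 : 1 - (r : ℂ) * z ≠ 0 := by
      simpa using one_sub_conj_mul_ne_zero hrn hz.le
    have h2 : ‖(-(r : ℂ) + z) / (1 + conj (-(r : ℂ)) * z)‖ < 1 :=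
      norm_moebius_lt_one (by simpa using hrn) hz
    have h3 : ‖(z - r) / (1 - r * z) * q z‖ ≤ 1 := by
      have : (-(r : ℂ) + z) / (1 + conj (-(r : ℂ)) * z) = (z - r) / (1 - r * z) := by
        simp only [map_neg, conj_ofReal]; ring
      rw [this] at h2
      rw [norm_mul]
      have := hq.2 z (by simpa using hz)
      nlinarith [norm_nonneg ((z - r) / (1 - r * z)), norm_nonneg (q z)]
    have h4 := one_add_conj_mul_ne_zero hb h3
    have : (1 - r * z) + conj b * ((z - r) * q z) =
        (1 - r * z) * (1 + conj b * ((z - r) / (1 - r * z) * q z)) := by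
      field_simp
    rw [this]
    exact mul_ne_zero h1 h4
  have hH1 : ∀ z, ‖z‖ < 1 → h z = lam + (z - r) * H z := by
    intro z hz
    have h1 := hd hk hlam hz
    have h2 := hhk z hz
    have h3 : H z * ((1 - r * z) + conj lam * ((z - r) * k z)) = (1 - conj lam * lam) * k z :=
      div_mul_cancel₀ _ h1
    apply mul_right_cancel₀ h1
    linear_combination h2 - (z - r) * h3
  have hG1 : ∀ z, ‖z‖ < 1 →
      f z = s + (a + r * (1 - a ^ 2) * lam / (1 - r ^ 2)) * (z - r) + (z - r) ^ 2 * G z := by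
    intro z hz
    have h1 := hd hh han hz
    rw [hac] at h1
    have h2 := hgh z hz
    have h3 : G z * ((1 - r ^ 2) * ((1 - r * z) + a * ((z - r) * h z))) = (1 - a ^ 2) *
        ((lam + z * H z) * (1 - r ^ 2) + r ^ 2 * lam - r * lam * a * h z) :=
      div_mul_cancel₀ _ (mul_ne_zero hr2 h1)
    have h4 := hH1 z hz
    have h5 : (s : ℂ) = r * a := by rw [ha]; field_simp
    rw [hfg z hz, h5]
    have h6 : r * (1 - a ^ 2) * lam / (1 - (r : ℂ) ^ 2) * (1 - (r : ℂ) ^ 2) =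
        r * (1 - a ^ 2) * lam := div_mul_cancel₀ _ hr2
    apply mul_right_cancel₀ (mul_ne_zero hr2 h1)
    linear_combination z * (1 - r ^ 2) * h2 -
      (z - r) * ((1 - r * z) + a * ((z - r) * h z)) * h6 - (z - r) ^ 2 * h3 +
      z * (1 - r ^ 2) * (1 - a ^ 2) * (z - r) * h4
  have hrb : ∀ᶠ z in 𝓝 (r : ℂ), ‖z‖ < 1 := by
    filter_upwards [isOpen_ball.mem_nhds (show (r : ℂ) ∈ ball (0 : ℂ) 1 by simpa using hrn)]
      with z hz
    simpa using hz
  have dk : ∀ {z : ℂ}, ‖z‖ < 1 → HasDerivAt H ((1 - conj lam * lam) *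
      (deriv k z * ((1 - r * z) + conj lam * ((z - r) * k z)) -
        k z * (-r + conj lam * (k z + (z - r) * deriv k z))) /
        ((1 - r * z) + conj lam * ((z - r) * k z)) ^ 2) z := by
    intro z hz
    have d := (hk.differentiableAt hz).hasDerivAt
    have i := hasDerivAt_id z
    have := (d.const_mul (1 - conj lam * lam)).div (((i.const_mul (r : ℂ)).const_sub 1).add
      (((i.sub_const (r : ℂ)).mul d).const_mul (conj lam))) (hd hk hlam hz)
    convert! this using 1
    simp
    ring
  have dG : ∀ {z : ℂ}, ‖z‖ < 1 → HasDerivAt G ((1 - a ^ 2) *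
      (((H z + z * deriv H z) * (1 - r ^ 2) - r * lam * a * deriv h z) *
          ((1 - r ^ 2) * ((1 - r * z) + a * ((z - r) * h z))) -
        ((lam + z * H z) * (1 - r ^ 2) + r ^ 2 * lam - r * lam * a * h z) *
          ((1 - r ^ 2) * (-r + a * (h z + (z - r) * deriv h z)))) /
        ((1 - r ^ 2) * ((1 - r * z) + a * ((z - r) * h z))) ^ 2) z := by
    intro z hz
    have d := (hh.differentiableAt hz).hasDerivAt
    have e := (dk hz).differentiableAt.hasDerivAt
    have i := hasDerivAt_id z
    have hne := mul_ne_zero hr2 (hd hh han hz)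
    rw [hac] at hne
    have := ((((((i.mul e).const_add lam).mul_const (1 - (r : ℂ) ^ 2)).add_const
      ((r : ℂ) ^ 2 * lam)).sub (d.const_mul (r * lam * a))).const_mul (1 - a ^ 2)).div
      ((((i.const_mul (r : ℂ)).const_sub 1).add
        (((i.sub_const (r : ℂ)).mul d).const_mul a)).const_mul (1 - (r : ℂ) ^ 2)) hne
    convert! this using 1
    simp
    ring
  have hGan : AnalyticAt ℂ G r := by
    rw [Complex.analyticAt_iff_eventually_differentiableAt]
    filter_upwards [hrb] with z hz using (dG hz).differentiableAt
  have hhd : deriv h r * (1 - r ^ 2) = k r * (1 - conj lam * lam) := by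
    have := hh.deriv_mul_eq hk hrn hhr (by simpa using hhk)
    simpa [sq] using this
  have hHr : H r = (1 - conj lam * lam) * k r / (1 - r ^ 2) := by simp [hH, sq]
  have hhd' : deriv h r = k r * (1 - conj lam * lam) / (1 - r ^ 2) := by
    rw [eq_div_iff hr2, hhd]
  have hC : coefC r s lam * (k r * (1 - eta r s lam * k r) +
      r / (1 + (r : ℂ) ^ 2 - 2 * s * lam) * ((1 - r ^ 2) * deriv k r)) =
      r * (1 - conj lam * lam) * ((1 + (r : ℂ) ^ 2 - 2 * s * lam) * k r -
        r * conj lam * k r ^ 2 + r * ((1 - r ^ 2) * deriv k r)) := by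
    rw [coefC, eta, ← conj_mul' lam]
    generalize 1 + (r : ℂ) ^ 2 - 2 * s * lam = D at hD
    field_simp
  rw [hC, iteratedDeriv_three_of_eventuallyEq hGan (hrb.mono hG1), (dG hrn).deriv, (dk hrn).deriv, hHr,
    hhr, hhd', coefA, coefB, ha]
  push_cast
  simp only [sub_self, zero_mul, mul_zero, add_zero, ← sq]
  field_simp
  ring

/-! ### Reduction of the region to a union of disks -/

/-- The union of the closed disks with centers `α (1 - η α)` and radii `t (1 - |α|²)` over the
closed unit disk. -/
def diskUnion (η : ℂ) (t : ℝ) : Set ℂ :=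
  {w | ∃ α β : ℂ, ‖α‖ ≤ 1 ∧ ‖β‖ ≤ 1 ∧
    w = α * (1 - η * α) + (t : ℂ) * (1 - (‖α‖ : ℂ) ^ 2) * β}

/-- The phase of `τ` is absorbed by rotating `β`. This passes from normalized `β` in the unit disk
to the jet variable, bounded by `1 - |α|²`. -/
theorem mem_diskUnion_iff_of_norm_eq {η τ w : ℂ} {t : ℝ} (ht : 0 < t) (hτ : ‖τ‖ = t) :
    w ∈ diskUnion η t ↔
      ∃ α β : ℂ, ‖α‖ ≤ 1 ∧ ‖β‖ ≤ 1 - ‖α‖ ^ 2 ∧ w = α * (1 - η * α) + τ * β := by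
  have hτ0 : τ ≠ 0 := norm_pos_iff.1 (hτ ▸ ht)
  have ht0 : (t : ℂ) ≠ 0 := by exact_mod_cast ht.ne'
  constructor
  · rintro ⟨α, β, hα, hβ, rfl⟩
    have h0 : 0 ≤ 1 - ‖α‖ ^ 2 := by nlinarith [norm_nonneg α]
    refine ⟨α, t / τ * ((1 - ‖α‖ ^ 2 : ℝ) : ℂ) * β, hα, ?_, ?_⟩
    · rw [norm_mul, norm_mul, norm_div, hτ, norm_real, norm_real, Real.norm_of_nonneg ht.le,
        Real.norm_of_nonneg h0, div_self ht.ne', one_mul]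
      exact mul_le_of_le_one_right h0 hβ
    · push_cast
      field_simp
  · rintro ⟨α, β, hα, hβ, rfl⟩
    have h0 : 0 ≤ 1 - ‖α‖ ^ 2 := by nlinarith [norm_nonneg α]
    -- If `|α| = 1` the quotient is `0` by the convention on division by zero, which is right since
    -- then `β = 0`.
    refine ⟨α, τ / t * (β / ((1 - ‖α‖ ^ 2 : ℝ) : ℂ)), hα, ?_, ?_⟩
    · rw [norm_mul, norm_div, norm_div, hτ, norm_real, norm_real, Real.norm_of_nonneg ht.le,
        Real.norm_of_nonneg h0, div_self ht.ne', one_mul]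
      exact div_le_one_of_le₀ hβ h0
    · rcases h0.eq_or_lt with h | h
      · have : β = 0 := norm_le_zero_iff.1 (by rw [h]; exact hβ)
        simp [this]
      · have h' : (1 : ℂ) - (‖α‖ : ℂ) ^ 2 ≠ 0 := by exact_mod_cast h.ne'
        push_cast
        field_simp

theorem denominator_ne_zero {r s : ℝ} {lam : ℂ} (hs : 0 ≤ s) (hsr : s < r) (hr : r < 1)
    (hlam : ‖lam‖ < 1) : 1 + (r : ℂ) ^ 2 - 2 * s * lam ≠ 0 := by
  intro h
  have h1 : (1 : ℂ) + (r : ℂ) ^ 2 = 2 * s * lam := by linear_combination h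
  have h2 := congrArg norm h1
  have h3 : ‖(1 : ℂ) + (r : ℂ) ^ 2‖ = 1 + r ^ 2 := by
    rw [← ofReal_pow, ← ofReal_one, ← ofReal_add, norm_real, Real.norm_of_nonneg (by positivity)]
  rw [h3, norm_mul, norm_mul, norm_real, Real.norm_of_nonneg hs] at h2
  norm_num at h2
  nlinarith [norm_nonneg lam]

theorem tPar_pos {r s : ℝ} {lam : ℂ} (hs : 0 ≤ s) (hsr : s < r) (hr : r < 1) (hlam : ‖lam‖ < 1) :
    0 < tPar r s lam :=
  div_pos (hs.trans_lt hsr) (norm_pos_iff.2 (denominator_ne_zero hs hsr hr hlam))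

/-- In fact `‖η‖ = t ‖lam‖`. The strict inequality is what gives unique support points. -/
theorem norm_eta_lt_tPar {r s : ℝ} {lam : ℂ} (hs : 0 ≤ s) (hsr : s < r) (hr : r < 1)
    (hlam : ‖lam‖ < 1) : ‖eta r s lam‖ < tPar r s lam := by
  have h : ‖eta r s lam‖ = tPar r s lam * ‖lam‖ := by
    rw [eta, tPar, norm_div, norm_mul, norm_real, Complex.norm_conj,
      Real.norm_of_nonneg (hs.trans hsr.le)]
    ring
  rw [h]
  exact mul_lt_of_lt_one_right (tPar_pos hs hsr hr hlam) hlam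

theorem coefA_mul_coefC_ne_zero {r s : ℝ} {lam : ℂ} (hs : 0 ≤ s) (hsr : s < r) (hr : r < 1)
    (hlam : ‖lam‖ < 1) : (coefA r s : ℂ) * coefC r s lam ≠ 0 := by
  have hr0 : 0 < r := hs.trans_lt hsr
  have h1 : 0 < coefA r s := by
    have h2 : 0 < 1 - r ^ 2 := by nlinarith
    have h3 : 0 < r ^ 2 - s ^ 2 := by nlinarith
    rw [coefA]; positivity
  have h2 : (1 : ℂ) - (‖lam‖ : ℂ) ^ 2 ≠ 0 := by
    have : 1 - ‖lam‖ ^ 2 ≠ 0 := by nlinarith [norm_nonneg lam]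
    exact_mod_cast this
  refine mul_ne_zero (by exact_mod_cast h1.ne') (mul_ne_zero (mul_ne_zero ?_ h2)
    (denominator_ne_zero hs hsr hr hlam))
  exact_mod_cast hr0.ne'

theorem region_eq_image_diskUnion {r s : ℝ} {lam : ℂ} (hs : 0 ≤ s) (hsr : s < r) (hr : r < 1)
    (hlam : ‖lam‖ < 1) :
    region r s lam = (fun w => (coefA r s : ℂ) * (coefB r s lam + coefC r s lam * w)) ''
      diskUnion (eta r s lam) (tPar r s lam) := by
  have hr0 : 0 < r := hs.trans_lt hsr
  have hrn : ‖(r : ℂ)‖ < 1 := by rwa [norm_real, Real.norm_of_nonneg hr0.le]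
  have hrb : (r : ℂ) ∈ ball (0 : ℂ) 1 := by simpa using hrn
  have hrc : (r : ℂ) ≠ 0 := by exact_mod_cast hr0.ne'
  have hr2 : (1 : ℂ) - r ^ 2 ≠ 0 := by
    have : (1 : ℝ) - r ^ 2 ≠ 0 := by nlinarith
    exact_mod_cast this
  have hrs : (r : ℂ) ^ 2 - s ^ 2 ≠ 0 := by
    have : r ^ 2 - s ^ 2 ≠ 0 := by nlinarith
    exact_mod_cast this
  have han : ‖(s / r : ℂ)‖ < 1 := by
    rw [norm_div, norm_real, norm_real, Real.norm_of_nonneg hr0.le, Real.norm_of_nonneg hs]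
    exact (div_lt_one hr0).2 hsr
  have hac : conj (s / r : ℂ) = s / r := by simp
  have hD := denominator_ne_zero hs hsr hr hlam
  have hτ : ‖(r : ℂ) / (1 + (r : ℂ) ^ 2 - 2 * s * lam)‖ = tPar r s lam := by
    rw [norm_div, norm_real, Real.norm_of_nonneg hr0.le, tPar]
  have hmem : ∀ w, w ∈ diskUnion (eta r s lam) (tPar r s lam) ↔ _ := fun w =>
    mem_diskUnion_iff_of_norm_eq (tPar_pos hs hsr hr hlam) hτ
  have hjet := fun α β : ℂ => exists_isSchur_iff (α := α) (β := β) hrn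
  simp only [conj_ofReal, ← sq] at hjet
  have hdf : ∀ {f g h : ℂ → ℂ}, IsSchur g → IsSchur h → (∀ z, ‖z‖ < 1 → f z = z * g z) →
      g r = s / r → (∀ z, ‖z‖ < 1 →
      (g z - s / r) * (1 - r * z) = h z * (z - r) * (1 - s / r * g z)) →
      deriv f r = s / r + (r ^ 2 - s ^ 2) / (r * (1 - (r : ℂ) ^ 2)) * h r := by
    intro f g h hg hh hfg hgr hgh
    have h1 := hg.deriv_mul_eq hh hrn hgr (by simpa [hac] using hgh)
    rw [hac, conj_ofReal] at h1
    have h2 : f =ᶠ[𝓝 (r : ℂ)] fun z => z * g z := by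
      filter_upwards [isOpen_ball.mem_nhds hrb] with z hz using hfg z (by simpa using hz)
    have h3 := ((hasDerivAt_id (r : ℂ)).mul (hg.differentiableAt hrn).hasDerivAt).deriv
    have h4 : deriv f r = g r + r * deriv g r := by
      rw [h2.deriv_eq]
      refine Eq.trans h3 ?_
      simp
    rw [h4, hgr, add_right_inj]
    have h5 : deriv g r = h r * (1 - s / r * (s / r)) / (1 - (r : ℂ) ^ 2) := by
      rw [eq_div_iff hr2, ← h1, sq]
    rw [h5]
    field_simp
  apply Subset.antisymm
  · rintro _ ⟨f, ⟨hfa, hfm, hf0, hfr, hfd⟩, rfl⟩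
    have hf : IsSchur f := ⟨hfa.differentiableOn, fun z hz => by
      simpa using (mem_ball_zero_iff.1 (hfm hz)).le⟩
    obtain ⟨g, hg, hfg⟩ := hf.exists_schur_parameter (p := 0) (by simp) (by simp [hf0])
    replace hfg : ∀ z, ‖z‖ < 1 → f z = z * g z := fun z hz => by
      simpa [hf0, mul_comm] using hfg z hz
    have hgr : g r = s / r := by
      rw [eq_div_iff hrc, ← hfr, hfg _ hrn, mul_comm]
    obtain ⟨h, hh, hgh⟩ := hg.exists_schur_parameter hrn (by rw [hgr]; exact han)
    simp only [hgr, hac, conj_ofReal] at hgh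
    -- The prescribed `f' r` determines `h r`, because its coefficient contains `r² - s² ≠ 0`.
    have hhr : h r = lam := by
      have h1 := hdf hg hh hfg hgr hgh
      rw [hfd, add_right_inj] at h1
      exact (mul_left_cancel₀ (div_ne_zero hrs (mul_ne_zero hrc hr2)) h1).symm
    obtain ⟨k, hk, hhk⟩ := hh.exists_schur_parameter hrn (by rw [hhr]; exact hlam)
    simp only [hhr, conj_ofReal] at hhk
    obtain ⟨hα, hβ⟩ := (hjet _ _).1 ⟨k, hk, rfl, rfl⟩
    exact ⟨_, (hmem _).2 ⟨_, _, hα, hβ, rfl⟩,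
      (iteratedDeriv_three_mul_eq hs hsr hr hlam hh hk hfg hhr hgh hhk hD).symm⟩
  · rintro _ ⟨w, hw, rfl⟩
    obtain ⟨α, β, hα, hβ, rfl⟩ := (hmem _).1 hw
    obtain ⟨k, hk, rfl, rfl⟩ := (hjet α β).2 ⟨hα, hβ⟩
    obtain ⟨h, hh, hhr, hhk⟩ := hk.exists_of_schur_parameter hrn hlam
    obtain ⟨g, hg, hgr, hgh⟩ := hh.exists_of_schur_parameter hrn han
    simp only [hac, conj_ofReal] at hgh hhk
    have hfg : ∀ z : ℂ, ‖z‖ < 1 → (fun z => z * g z) z = z * g z := fun _ _ => rfl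
    refine ⟨fun z => z * g z, ⟨?_, ?_, ?_, ?_, ?_⟩, ?_⟩
    · exact (differentiableOn_id.mul hg.1).analyticOnNhd isOpen_ball
    · intro z hz
      have h1 : ‖z‖ < 1 := by simpa using hz
      have h2 := hg.2 z hz
      rw [mem_ball_zero_iff, norm_mul]
      nlinarith [norm_nonneg z, norm_nonneg (g z)]
    · simp
    · simp only [hgr]; field_simp
    · rw [hdf hg hh hfg hgr hgh, hhr]
    · exact iteratedDeriv_three_mul_eq hs hsr hr hlam hh hk hfg hhr hgh hhk hD

/-! ### Compactness and convexity of the union of disks -/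

theorem isCompact_diskUnion (η : ℂ) (t : ℝ) : IsCompact (diskUnion η t) := by
  have : diskUnion η t = (fun x : ℂ × ℂ => x.1 * (1 - η * x.1) +
      (t : ℂ) * (1 - (‖x.1‖ : ℂ) ^ 2) * x.2) '' (closedBall 0 1 ×ˢ closedBall 0 1) := by
    ext w
    simp only [diskUnion, mem_ofPred_eq, mem_image, mem_prod, mem_closedBall_zero_iff, Prod.exists]
    constructor
    · rintro ⟨α, β, hα, hβ, rfl⟩
      exact ⟨α, β, ⟨hα, hβ⟩, rfl⟩
    · rintro ⟨α, β, ⟨hα, hβ⟩, rfl⟩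
      exact ⟨α, β, hα, hβ, rfl⟩
  rw [this]
  exact ((isCompact_closedBall _ _).prod (isCompact_closedBall _ _)).image (by fun_prop)

/-- Averaging `α₁, α₂` with weights `p, q` creates the defect `η p q (α₁ - α₂)²` in `α (1 - η α)`,
while `1 - |α|²` exceeds the average of its values by `p q |α₁ - α₂|²`. As `‖η‖ ≤ t`, the gain
leaves room for `β` to cancel the defect. -/
theorem convex_diskUnion {η : ℂ} {t : ℝ} (ht : 0 < t) (hη : ‖η‖ ≤ t) :
    Convex ℝ (diskUnion η t) := by
  have hτ : ‖(t : ℂ)‖ = t := by rw [norm_real, Real.norm_of_nonneg ht.le]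
  have ht0 : (t : ℂ) ≠ 0 := by exact_mod_cast ht.ne'
  intro w₁ h₁ w₂ h₂ p q hp hq hpq
  rw [mem_diskUnion_iff_of_norm_eq ht hτ] at h₁ h₂ ⊢
  obtain ⟨α₁, β₁, hα₁, hβ₁, rfl⟩ := h₁
  obtain ⟨α₂, β₂, hα₂, hβ₂, rfl⟩ := h₂
  have hpqc : (q : ℂ) = 1 - p := by
    have : q = 1 - p := by linarith
    rw [this]; push_cast; ring
  refine ⟨p * α₁ + q * α₂, p * β₁ + q * β₂ + (-(η / t * (p * q) * (α₁ - α₂) ^ 2)), ?_, ?_, ?_⟩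
  · calc ‖(p : ℂ) * α₁ + q * α₂‖ ≤ ‖(p : ℂ) * α₁‖ + ‖(q : ℂ) * α₂‖ := norm_add_le _ _
      _ = p * ‖α₁‖ + q * ‖α₂‖ := by
        rw [norm_mul, norm_mul, norm_real, norm_real, Real.norm_of_nonneg hp,
          Real.norm_of_nonneg hq]
      _ ≤ 1 := by nlinarith
  · have hid : ‖(p : ℂ) * α₁ + q * α₂‖ ^ 2 =
        p * ‖α₁‖ ^ 2 + q * ‖α₂‖ ^ 2 - p * q * ‖α₁ - α₂‖ ^ 2 := by
      have : q = 1 - p := by linarith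
      subst this
      simp only [Complex.sq_norm, Complex.normSq_apply, add_re, add_im, mul_re, mul_im, ofReal_re,
        ofReal_im, sub_re, sub_im]
      ring
    have h3 : ‖-(η / t * (p * q) * (α₁ - α₂) ^ 2)‖ ≤ p * q * ‖α₁ - α₂‖ ^ 2 := by
      rw [norm_neg, norm_mul, norm_mul, norm_mul, norm_div, norm_pow, hτ, norm_real, norm_real,
        Real.norm_of_nonneg hp, Real.norm_of_nonneg hq]
      have : ‖η‖ / t ≤ 1 := (div_le_one ht).2 hη
      have h4 : 0 ≤ p * q * ‖α₁ - α₂‖ ^ 2 := by positivity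
      nlinarith
    have h5 : ‖(p : ℂ) * β₁ + q * β₂‖ ≤ p * ‖β₁‖ + q * ‖β₂‖ := by
      refine (norm_add_le _ _).trans_eq ?_
      rw [norm_mul, norm_mul, norm_real, norm_real, Real.norm_of_nonneg hp,
        Real.norm_of_nonneg hq]
    have h6 := norm_add_le ((p : ℂ) * β₁ + q * β₂) (-(η / t * (p * q) * (α₁ - α₂) ^ 2))
    have h7 := mul_le_mul_of_nonneg_left hβ₁ hp
    have h8 := mul_le_mul_of_nonneg_left hβ₂ hq
    rw [hid]
    nlinarith
  · rw [real_smul, real_smul]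
    have : (t : ℂ) * (η / t) = η := by field_simp
    rw [hpqc]
    linear_combination (p : ℂ) * (1 - p) * (α₁ - α₂) ^ 2 * this

theorem nonempty_interior_diskUnion {η : ℂ} {t : ℝ} (ht : 0 < t) :
    (interior (diskUnion η t)).Nonempty := by
  refine ⟨0, mem_interior.2 ⟨ball 0 t, fun w hw => ?_, isOpen_ball, by simpa using ht⟩⟩
  have ht0 : (t : ℂ) ≠ 0 := by exact_mod_cast ht.ne'
  refine ⟨0, w / t, by simp, ?_, ?_⟩
  · rw [norm_div, norm_real, Real.norm_of_nonneg ht.le]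
    exact (div_le_one ht).2 (by simpa using (mem_ball_zero_iff.1 hw).le)
  · simp only [norm_zero]
    field_simp
    simp

/-! ### Support points and the Lagrange condition -/

/-- The Lagrange condition for `ζ` to maximize `Re (conj e * α (1 - η α)) + x (1 - |α|²)`. -/
theorem re_add_le_of_critical {η e ζ : ℂ} {x : ℝ} (he : ‖e‖ = 1)
    (hζ : 2 * x * ζ = e * (1 - 2 * conj η * conj ζ)) (α : ℂ) :
    (conj e * (α * (1 - η * α))).re + x * (1 - ‖α‖ ^ 2) + (x - ‖η‖) * ‖α - ζ‖ ^ 2 ≤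
      (conj e * (ζ * (1 - η * ζ))).re + x * (1 - ‖ζ‖ ^ 2) := by
  have hee : conj e * e = 1 := by rw [conj_mul', he]; simp
  have h1 : conj e * (1 - 2 * η * ζ) = 2 * x * conj ζ := by
    have := congrArg conj hζ
    simp only [map_mul, map_sub, map_one, map_ofNat, conj_conj, conj_ofReal] at this
    exact this.symm
  -- Exact second-order expansion at `ζ`, with the linear term rewritten by the stationarity
  -- condition.
  have h2 : conj e * (α * (1 - η * α)) = conj e * (ζ * (1 - η * ζ)) +
      2 * x * (conj ζ * (α - ζ)) - conj e * η * (α - ζ) ^ 2 := by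
    linear_combination (α - ζ) * h1
  have h3 : ‖α‖ ^ 2 = ‖ζ‖ ^ 2 + 2 * (conj ζ * (α - ζ)).re + ‖α - ζ‖ ^ 2 := by
    simp only [Complex.sq_norm, Complex.normSq_apply, mul_re, sub_re, sub_im, conj_re, conj_im]
    ring
  have h4 : (2 * x * (conj ζ * (α - ζ))).re = 2 * x * (conj ζ * (α - ζ)).re := by
    rw [← ofReal_ofNat, ← ofReal_mul, re_ofReal_mul]
  have h5 : -(conj e * η * (α - ζ) ^ 2).re ≤ ‖η‖ * ‖α - ζ‖ ^ 2 := by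
    have := (neg_le_abs _).trans (abs_re_le_norm (conj e * η * (α - ζ) ^ 2))
    simpa [he] using this
  rw [h2, sub_re, add_re, h4, h3]
  linarith

/-- `ζ` determines the support point of `diskUnion η t` in the direction `e`. -/
def IsSupport (η : ℂ) (t : ℝ) (e ζ : ℂ) : Prop :=
  ‖ζ‖ ≤ 1 ∧ ∃ x : ℝ, t ≤ x ∧ 2 * x * ζ = e * (1 - 2 * conj η * conj ζ) ∧ (x = t ∨ ‖ζ‖ = 1)

/-- The support point in the direction `e` that belongs to `ζ`. -/
def supportPoint (η : ℂ) (t : ℝ) (e ζ : ℂ) : ℂ :=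
  ζ * (1 - η * ζ) + (t : ℂ) * (1 - (‖ζ‖ : ℂ) ^ 2) * e

theorem supportPoint_mem {η e ζ : ℂ} {t : ℝ} (he : ‖e‖ = 1) (hζ : ‖ζ‖ ≤ 1) :
    supportPoint η t e ζ ∈ diskUnion η t := ⟨ζ, e, hζ, he.le, rfl⟩

theorem re_conj_mul_add (e a b : ℂ) (t u : ℝ) :
    (conj e * (a + (t : ℂ) * (1 - (u : ℂ) ^ 2) * b)).re =
      (conj e * a).re + t * (1 - u ^ 2) * (conj e * b).re := by
  have : conj e * (a + (t : ℂ) * (1 - (u : ℂ) ^ 2) * b) =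
      conj e * a + ((t * (1 - u ^ 2) : ℝ) : ℂ) * (conj e * b) := by push_cast; ring
  rw [this, add_re, re_ofReal_mul]

theorem re_conj_mul_supportPoint {η e ζ : ℂ} {t : ℝ} (he : ‖e‖ = 1) :
    (conj e * supportPoint η t e ζ).re =
      (conj e * (ζ * (1 - η * ζ))).re + t * (1 - ‖ζ‖ ^ 2) := by
  have hee : conj e * e = 1 := by rw [conj_mul', he]; simp
  rw [supportPoint, re_conj_mul_add, hee]
  simp

/-- The multiplier `x` can be replaced by `t`: complementary slackness makes the two agree at `ζ`,
and `x ≥ t` only helps at other `α` in the disk. The quadratic gap on the left gives uniqueness of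
the maximizer. -/
theorem IsSupport.re_add_le {η e ζ α : ℂ} {t : ℝ} (he : ‖e‖ = 1)
    (h : IsSupport η t e ζ) (hα : ‖α‖ ≤ 1) :
    (conj e * (α * (1 - η * α))).re + t * (1 - ‖α‖ ^ 2) + (t - ‖η‖) * ‖α - ζ‖ ^ 2 ≤
      (conj e * supportPoint η t e ζ).re := by
  obtain ⟨-, x, hx, hcrit, hcompl⟩ := h
  have h1 := re_add_le_of_critical he hcrit α
  have h2 : x * (1 - ‖ζ‖ ^ 2) = t * (1 - ‖ζ‖ ^ 2) := by
    rcases hcompl with rfl | h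
    · rfl
    · rw [h]; ring
  have h3 : 0 ≤ (x - t) * (1 - ‖α‖ ^ 2) :=
    mul_nonneg (by linarith) (by nlinarith [norm_nonneg α])
  have h4 : 0 ≤ (x - t) * ‖α - ζ‖ ^ 2 := mul_nonneg (by linarith) (by positivity)
  rw [re_conj_mul_supportPoint he]
  linarith

theorem IsSupport.eq_of_le {η e ζ α : ℂ} {t : ℝ} (hη : ‖η‖ < t) (he : ‖e‖ = 1)
    (h : IsSupport η t e ζ) (hα : ‖α‖ ≤ 1)
    (hle : (conj e * supportPoint η t e ζ).re ≤
      (conj e * (α * (1 - η * α))).re + t * (1 - ‖α‖ ^ 2)) : α = ζ := by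
  have h1 := h.re_add_le he hα
  have h2 : (t - ‖η‖) * ‖α - ζ‖ ^ 2 ≤ 0 := by linarith
  have h3 : ‖α - ζ‖ ^ 2 ≤ 0 := nonpos_of_mul_nonpos_right h2 (sub_pos.2 hη)
  have h4 : ‖α - ζ‖ = 0 := pow_eq_zero_iff two_ne_zero |>.1 (le_antisymm h3 (by positivity))
  exact sub_eq_zero.1 (norm_eq_zero.1 h4)

theorem IsSupport.unique {η e ζ ζ' : ℂ} {t : ℝ} (hη : ‖η‖ < t) (he : ‖e‖ = 1)
    (h : IsSupport η t e ζ) (h' : IsSupport η t e ζ') : ζ = ζ' := by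
  rcases le_total (conj e * supportPoint η t e ζ).re (conj e * supportPoint η t e ζ').re
    with hle | hle
  · rw [re_conj_mul_supportPoint he (ζ := ζ')] at hle
    exact (h.eq_of_le hη he h'.1 hle).symm
  · rw [re_conj_mul_supportPoint he (ζ := ζ)] at hle
    exact h'.eq_of_le hη he h.1 hle

theorem re_conj_mul_le_one {e β : ℂ} (he : ‖e‖ = 1) (hβ : ‖β‖ ≤ 1) : (conj e * β).re ≤ 1 :=
  (re_le_norm _).trans (by rw [norm_mul, Complex.norm_conj, he, one_mul]; exact hβ)

theorem IsSupport.re_le {η e ζ w : ℂ} {t : ℝ} (ht : 0 ≤ t) (hη : ‖η‖ ≤ t) (he : ‖e‖ = 1)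
    (h : IsSupport η t e ζ) (hw : w ∈ diskUnion η t) :
    (conj e * w).re ≤ (conj e * supportPoint η t e ζ).re := by
  obtain ⟨α, β, hα, hβ, rfl⟩ := hw
  have h1 := h.re_add_le he hα
  have h2 := re_conj_mul_le_one he hβ
  have h3 : 0 ≤ t * (1 - ‖α‖ ^ 2) := mul_nonneg ht (by nlinarith [norm_nonneg α])
  have h4 : 0 ≤ (t - ‖η‖) * ‖α - ζ‖ ^ 2 := mul_nonneg (by linarith) (by positivity)
  rw [re_conj_mul_add]
  nlinarith

/-- Equality forces `α = ζ` by the quadratic gap. Then either `|ζ| = 1` and `β` has weight zero, or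
`Re (conj e β) = 1` with `|β| ≤ 1`, so `β = e`. -/
theorem IsSupport.eq_supportPoint {η e ζ w : ℂ} {t : ℝ} (hη : ‖η‖ < t) (he : ‖e‖ = 1)
    (h : IsSupport η t e ζ) (hw : w ∈ diskUnion η t)
    (hle : (conj e * supportPoint η t e ζ).re ≤ (conj e * w).re) :
    w = supportPoint η t e ζ := by
  have ht : 0 < t := (norm_nonneg η).trans_lt hη
  obtain ⟨α, β, hα, hβ, rfl⟩ := hw
  have h2 := re_conj_mul_le_one he hβ
  have h3 : 0 ≤ t * (1 - ‖α‖ ^ 2) := mul_nonneg ht.le (by nlinarith [norm_nonneg α])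
  rw [re_conj_mul_add] at hle
  have hαζ := h.eq_of_le hη he hα (by nlinarith)
  subst hαζ
  rw [re_conj_mul_supportPoint he] at hle
  rcases hα.lt_or_eq with hlt | heq
  · have h4 : 0 < t * (1 - ‖α‖ ^ 2) := mul_pos ht (by nlinarith [norm_nonneg α])
    have h5 : (conj e * β).re = 1 := le_antisymm h2 (by nlinarith)
    have h6 : ‖β - e‖ ^ 2 ≤ 0 := by
      have h7 : ‖β - e‖ ^ 2 = ‖β‖ ^ 2 - 2 * (conj e * β).re + ‖e‖ ^ 2 := by
        simp only [Complex.sq_norm, Complex.normSq_apply, mul_re, sub_re, sub_im, conj_re, conj_im]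
        ring
      rw [h7, h5, he]
      nlinarith [norm_nonneg β]
    have h8 : ‖β - e‖ = 0 := pow_eq_zero_iff two_ne_zero |>.1 (le_antisymm h6 (by positivity))
    rw [supportPoint, sub_eq_zero.1 (norm_eq_zero.1 h8)]
  · simp [supportPoint, heq]

theorem exists_unit_direction (f : StrongDual ℝ ℂ) (hf : f ≠ 0) :
    ∃ (e : ℂ) (ρ : ℝ), ‖e‖ = 1 ∧ 0 < ρ ∧ ∀ z, f z = ρ * (conj e * z).re := by
  -- The Riesz vector of `f`; `e` is its normalization.
  set v : ℂ := f 1 + f I * I with hv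
  have hfv : ∀ z, f z = (conj v * z).re := by
    intro z
    have : z = z.re • (1 : ℂ) + z.im • I := by
      simp [real_smul]
    conv_lhs => rw [this]
    rw [map_add, map_smul, map_smul]
    simp [hv]
    ring
  have hv0 : v ≠ 0 := by
    rintro h
    apply hf
    exact ContinuousLinearMap.ext fun z => by simp [hfv, h]
  have hvn : (‖v‖ : ℂ) ≠ 0 := by exact_mod_cast norm_ne_zero_iff.2 hv0
  refine ⟨v / ‖v‖, ‖v‖, ?_, norm_pos_iff.2 hv0, fun z => ?_⟩
  · rw [norm_div, norm_real, norm_norm, div_self (norm_ne_zero_iff.2 hv0)]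
  · rw [hfv, ← re_ofReal_mul]
    congr 1
    simp only [map_div₀, conj_ofReal]
    field_simp

/-- A boundary point has a supporting line, and the support point in its normal direction is unique.
Conversely, a support point in the interior could be pushed along `e`, increasing the maximal value.
-/
theorem frontier_diskUnion {η : ℂ} {t : ℝ} (hη : ‖η‖ < t) {Z : ℂ → ℂ}
    (hZ : ∀ e, ‖e‖ = 1 → IsSupport η t e (Z e)) :
    frontier (diskUnion η t) = (fun e => supportPoint η t e (Z e)) '' sphere 0 1 := by
  have ht : 0 < t := (norm_nonneg η).trans_lt hη
  have hcl : IsClosed (diskUnion η t) := (isCompact_diskUnion η t).isClosed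
  have hconv := convex_diskUnion ht hη.le
  rw [hcl.frontier_eq]
  ext w
  simp only [mem_sdiff, mem_image, mem_sphere_zero_iff_norm]
  constructor
  · rintro ⟨hw, hwi⟩
    obtain ⟨f, hf⟩ := geometric_hahn_banach_open_point hconv.interior isOpen_interior hwi
    have hf0 : f ≠ 0 := by
      rintro rfl
      obtain ⟨a, ha⟩ := nonempty_interior_diskUnion (η := η) ht
      simpa using hf a ha
    obtain ⟨e, ρ, he, hρ, hfe⟩ := exists_unit_direction f hf0
    have hle : ∀ a ∈ diskUnion η t, f a ≤ f w := by
      -- The separation was only from the interior; its closure contains the whole convex set.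
      intro a ha
      have hac : a ∈ closure (interior (diskUnion η t)) := by
        rw [hconv.closure_interior_eq_closure_of_nonempty_interior
          (nonempty_interior_diskUnion ht)]
        exact subset_closure ha
      have hsub : closure (interior (diskUnion η t)) ⊆ {a | f a ≤ f w} :=
        closure_minimal (fun a ha => (hf a ha).le) (isClosed_le f.continuous continuous_const)
      exact hsub hac
    refine ⟨e, he, ?_⟩
    have h1 := hle _ (supportPoint_mem (η := η) (t := t) he (hZ e he).1)
    rw [hfe, hfe] at h1
    exact ((hZ e he).eq_supportPoint hη he hw (le_of_mul_le_mul_left h1 hρ)).symm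
  · rintro ⟨e, he, rfl⟩
    refine ⟨supportPoint_mem he (hZ e he).1, fun hint => ?_⟩
    set w := supportPoint η t e (Z e) with hw
    have hee : conj e * e = 1 := by rw [conj_mul', he]; simp
    obtain ⟨ε, hε, hball⟩ := Metric.mem_nhds_iff.1 (mem_interior_iff_mem_nhds.1 hint)
    have hmem : w + (ε / 2 : ℝ) * e ∈ diskUnion η t := hball (by
      rw [mem_ball_iff_norm, add_sub_cancel_left, norm_mul, he, norm_real,
        Real.norm_of_nonneg (by positivity)]
      linarith)
    have h1 := (hZ e he).re_le ht.le hη.le he hmem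
    have h2 : conj e * (w + (ε / 2 : ℝ) * e) = conj e * w + (ε / 2 : ℝ) := by
      linear_combination (ε / 2 : ℝ) * hee
    rw [h2, add_re, ofReal_re] at h1
    linarith

/-! ### Solving the stationarity equation; the number `t_θ` -/

/-- The solution `ζ` of `2 x ζ = e (1 - 2 conj η conj ζ)`. -/
def critical (η : ℂ) (x : ℝ) (e : ℂ) : ℂ :=
  ((x : ℂ) * e - conj η) / (2 * ((x : ℂ) ^ 2 - (‖η‖ : ℂ) ^ 2))

theorem sq_sub_sq_norm_pos {η : ℂ} {x : ℝ} (hx : ‖η‖ < x) : 0 < x ^ 2 - ‖η‖ ^ 2 := by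
  nlinarith [norm_nonneg η]

theorem sq_sub_sq_norm_ne_zero {η : ℂ} {x : ℝ} (hx : ‖η‖ < x) :
    (x : ℂ) ^ 2 - (‖η‖ : ℂ) ^ 2 ≠ 0 := by
  exact_mod_cast (sq_sub_sq_norm_pos hx).ne'

/-- The equation and its conjugate form a linear system in `ζ` and `conj ζ`, nonsingular because `x²
≠ |η|²`. -/
theorem critical_eq_iff {η e ζ : ℂ} {x : ℝ} (hx : ‖η‖ < x) (he : ‖e‖ = 1) :
    2 * x * ζ = e * (1 - 2 * conj η * conj ζ) ↔ ζ = critical η x e := by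
  have hee : conj e * e = 1 := by rw [conj_mul', he]; simp
  have hD := sq_sub_sq_norm_ne_zero hx
  have hηη : conj η * η = (‖η‖ : ℂ) ^ 2 := conj_mul' η
  constructor
  · intro h
    have h1 : 2 * x * conj ζ = conj e * (1 - 2 * η * ζ) := by
      have := congrArg conj h
      simpa only [map_mul, map_sub, map_one, map_ofNat, conj_conj, conj_ofReal] using this
    rw [critical, eq_div_iff (mul_ne_zero two_ne_zero hD), ← hηη]
    linear_combination x * h - e * conj η * h1 - conj η * (1 - 2 * η * ζ) * hee
  · rintro rfl
    have h1 : conj (critical η x e) = (x * conj e - η) / (2 * ((x : ℂ) ^ 2 - (‖η‖ : ℂ) ^ 2)) := by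
      simp only [critical, map_div₀, map_sub, map_mul, map_pow, map_ofNat, conj_conj, conj_ofReal]
    rw [h1, critical]
    field_simp
    linear_combination (x : ℂ) * conj η * hee - e * hηη

theorem norm_critical {η e : ℂ} {x : ℝ} (hx : ‖η‖ < x) :
    ‖critical η x e‖ = ‖(x : ℂ) * e - conj η‖ / (2 * (x ^ 2 - ‖η‖ ^ 2)) := by
  have : (2 : ℂ) * ((x : ℂ) ^ 2 - (‖η‖ : ℂ) ^ 2) = ((2 * (x ^ 2 - ‖η‖ ^ 2) : ℝ) : ℂ) := by
    push_cast; ring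
  have h := sq_sub_sq_norm_pos hx
  rw [critical, norm_div, this, norm_real, Real.norm_of_nonneg (by positivity)]

theorem isSol_iff {η : ℂ} {θ x : ℝ} :
    IsSol η θ x ↔ ‖η‖ < x ∧ ‖critical η x (exp (θ * I))‖ = 1 := by
  refine and_congr_right fun hx => ?_
  have h := sq_sub_sq_norm_pos hx
  rw [norm_critical hx, div_eq_one_iff_eq (by positivity)]

theorem isSupport_critical {η e : ℂ} {t x : ℝ} (hx : ‖η‖ < x) (he : ‖e‖ = 1) (htx : t ≤ x)
    (h : ‖critical η x e‖ = 1) : IsSupport η t e (critical η x e) :=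
  ⟨h.le, x, htx, (critical_eq_iff hx he).2 rfl, Or.inr h⟩

/-- For `x ≤ y` both critical points satisfy the support condition with weight `x` in direction `e`,
hence coincide; the stationarity equation then recovers the multiplier. -/
theorem eq_of_norm_critical_eq_one {η e : ℂ} {x y : ℝ} (hx : ‖η‖ < x) (hy : ‖η‖ < y)
    (he : ‖e‖ = 1) (h : ‖critical η x e‖ = 1) (h' : ‖critical η y e‖ = 1) : x = y := by
  wlog hxy : x ≤ y generalizing x y
  · exact (this hy hx h' h (le_of_not_ge hxy)).symm
  have heq := (isSupport_critical hx he le_rfl h).unique hx he (isSupport_critical hy he hxy h')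
  have h1 := (critical_eq_iff hx he).2 rfl
  have h2 := (critical_eq_iff hy he).2 rfl
  rw [← heq, ← h1] at h2
  have h0 : critical η x e ≠ 0 := norm_ne_zero_iff.1 (by rw [h]; exact one_ne_zero)
  have h3 := mul_left_cancel₀ two_ne_zero (mul_right_cancel₀ h0 h2)
  exact_mod_cast h3.symm

theorem exists_norm_critical_eq_one {η e : ℂ} {t : ℝ} (ht : ‖η‖ < t) (he : ‖e‖ = 1)
    (h : 2 * (t ^ 2 - ‖η‖ ^ 2) ≤ ‖(t : ℂ) * e - conj η‖) :
    ∃ x, t ≤ x ∧ ‖critical η x e‖ = 1 := by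
  -- At `T` the inequality is reversed, since `T - |η| > 1` gives `T + |η| ≤ 2 (T² - |η|²)`; a zero
  -- lies between.
  set T : ℝ := t + 1 with hT
  have hTn : ‖(T : ℂ) * e - conj η‖ ≤ 2 * (T ^ 2 - ‖η‖ ^ 2) := by
    have h1 : ‖(T : ℂ) * e - conj η‖ ≤ T + ‖η‖ := by
      refine (norm_sub_le _ _).trans ?_
      rw [norm_mul, he, norm_real, Complex.norm_conj, mul_one, Real.norm_of_nonneg]
      linarith [norm_nonneg η]
    nlinarith [norm_nonneg η]
  have hcont : ContinuousOn (fun x : ℝ => ‖(x : ℂ) * e - conj η‖ - 2 * (x ^ 2 - ‖η‖ ^ 2))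
      (Icc t T) := by fun_prop
  obtain ⟨x, hx, hx0⟩ := intermediate_value_Icc' (by linarith : t ≤ T) hcont
    (show (0 : ℝ) ∈ Icc _ _ from ⟨by linarith, by linarith⟩)
  refine ⟨x, hx.1, ?_⟩
  have hx' : ‖η‖ < x := ht.trans_le hx.1
  have := sq_sub_sq_norm_pos hx'
  rw [norm_critical hx', div_eq_one_iff_eq (by positivity)]
  linarith

theorem norm_exp_mul_I (θ : ℝ) : ‖exp (θ * I)‖ = 1 := norm_exp_ofReal_mul_I θ

theorem existsUnique_isSol {η : ℂ} {t θ : ℝ} (ht : ‖η‖ < t)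
    (h : 2 * (t ^ 2 - ‖η‖ ^ 2) ≤ ‖(t : ℂ) * exp (θ * I) - conj η‖) : ∃! x, IsSol η θ x := by
  obtain ⟨x, hx, hx1⟩ := exists_norm_critical_eq_one ht (norm_exp_mul_I θ) h
  refine ⟨x, isSol_iff.2 ⟨ht.trans_le hx, hx1⟩, fun y hy => ?_⟩
  obtain ⟨hy, hy1⟩ := isSol_iff.1 hy
  exact eq_of_norm_critical_eq_one hy (ht.trans_le hx) (norm_exp_mul_I θ) hy1 hx1

/-- Uniqueness identifies the chosen solution with the one found in `[t, t + 1]`; this is how the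
multiplier bound `t ≤ t_θ` arises. -/
theorem tTheta_of_le {η : ℂ} {t θ : ℝ} (ht : ‖η‖ < t)
    (h : 2 * (t ^ 2 - ‖η‖ ^ 2) ≤ ‖(t : ℂ) * exp (θ * I) - conj η‖) :
    t ≤ tTheta t η θ ∧ IsSol η θ (tTheta t η θ) := by
  have h1 : tTheta t η θ = Classical.epsilon (IsSol η θ) := if_pos h
  have h2 : IsSol η θ (tTheta t η θ) := by
    rw [h1]; exact Classical.epsilon_spec (existsUnique_isSol ht h).exists
  obtain ⟨x, hx, hx1⟩ := exists_norm_critical_eq_one ht (norm_exp_mul_I θ) h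
  rw [(existsUnique_isSol ht h).unique h2 (isSol_iff.2 ⟨ht.trans_le hx, hx1⟩)]
  exact ⟨hx, isSol_iff.2 ⟨ht.trans_le hx, hx1⟩⟩

theorem zetaTheta_eq_critical (t : ℝ) (η : ℂ) (θ : ℝ) :
    zetaTheta t η θ = critical η (tTheta t η θ) (exp (θ * I)) := rfl

theorem norm_zetaTheta_of_le {η : ℂ} {t θ : ℝ} (ht : ‖η‖ < t)
    (h : 2 * (t ^ 2 - ‖η‖ ^ 2) ≤ ‖(t : ℂ) * exp (θ * I) - conj η‖) :
    ‖zetaTheta t η θ‖ = 1 := (isSol_iff.1 (tTheta_of_le ht h).2).2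

theorem isSupport_critical_of_le {η e : ℂ} {t : ℝ} (ht : ‖η‖ < t) (he : ‖e‖ = 1)
    (h : ‖(t : ℂ) * e - conj η‖ ≤ 2 * (t ^ 2 - ‖η‖ ^ 2)) :
    IsSupport η t e (critical η t e) := by
  have := sq_sub_sq_norm_pos ht
  refine ⟨?_, t, le_rfl, (critical_eq_iff ht he).2 rfl, Or.inl rfl⟩
  rw [norm_critical ht]
  exact (div_le_one (by positivity)).2 h

/-- The two branches of `tTheta` are the active and the inactive constraint. -/
theorem isSupport_zetaTheta {η : ℂ} {t : ℝ} (ht : ‖η‖ < t) (θ : ℝ) :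
    IsSupport η t (exp (θ * I)) (zetaTheta t η θ) := by
  rw [zetaTheta_eq_critical]
  by_cases h : 2 * (t ^ 2 - ‖η‖ ^ 2) ≤ ‖(t : ℂ) * exp (θ * I) - conj η‖
  · obtain ⟨h1, h2⟩ := tTheta_of_le ht h
    exact isSupport_critical h2.1 (norm_exp_mul_I θ) h1 (isSol_iff.1 h2).2
  · have : tTheta t η θ = t := if_neg h
    rw [this]
    exact isSupport_critical_of_le ht (norm_exp_mul_I θ) (le_of_not_ge h)

/-- Stationarity with `x = t` collapses the quadratic terms and leaves `ζ / 2 + t e`, which is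
affine in `e`. This is the source of the circle. -/
theorem supportPoint_critical {η e : ℂ} {t : ℝ} (ht : ‖η‖ < t) (he : ‖e‖ = 1) :
    supportPoint η t e (critical η t e) =
      ((1 + 4 * ((t : ℂ) ^ 2 - (‖η‖ : ℂ) ^ 2)) * t * e - conj η) /
        (4 * ((t : ℂ) ^ 2 - (‖η‖ : ℂ) ^ 2)) := by
  have hee : conj e * e = 1 := by rw [conj_mul', he]; simp
  have hD := sq_sub_sq_norm_ne_zero ht
  have h1 := (critical_eq_iff ht he).2 rfl
  set ζ := critical η t e with hζ
  have h2 : 2 * t * conj ζ = conj e * (1 - 2 * η * ζ) := by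
    have := congrArg conj h1
    simpa only [map_mul, map_sub, map_one, map_ofNat, conj_conj, conj_ofReal] using this
  have h3 : supportPoint η t e ζ = ζ / 2 + t * e := by
    rw [supportPoint, ← conj_mul' ζ]
    linear_combination (-1 / 2 : ℂ) * e * ζ * h2 - (1 / 2 : ℂ) * ζ * (1 - 2 * η * ζ) * hee
  rw [h3, hζ, critical]
  field_simp
  ring

theorem supportPoint_of_norm_eq_one {η e ζ : ℂ} {t : ℝ} (hζ : ‖ζ‖ = 1) :
    supportPoint η t e ζ = ζ * (1 - η * ζ) := by simp [supportPoint, hζ]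

/-! ### Unimodular support parameters and the shape of the frontier -/

/-- The unimodular points that determine support points of `diskUnion η t`. -/
def supportArc (η : ℂ) (t : ℝ) : Set ℂ := {ζ | ‖ζ‖ = 1 ∧ 2 * t ≤ ‖1 - 2 * η * ζ‖}

theorem IsSupport.mem_supportArc {η e ζ : ℂ} {t : ℝ} (he : ‖e‖ = 1) (h : IsSupport η t e ζ)
    (hζ : ‖ζ‖ = 1) : ζ ∈ supportArc η t := by
  obtain ⟨-, x, hx, h1, -⟩ := h
  refine ⟨hζ, ?_⟩
  have h2 := congrArg norm h1
  have h3 : ‖1 - 2 * conj η * conj ζ‖ = ‖1 - 2 * η * ζ‖ := by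
    rw [← Complex.norm_conj (1 - 2 * η * ζ)]
    simp only [map_sub, map_mul, map_one, map_ofNat]
  rw [norm_mul, norm_mul, norm_mul, hζ, he, h3, norm_real, Real.norm_eq_abs] at h2
  norm_num at h2
  linarith [le_abs_self x]

/-- For `|ζ| = 1` the stationarity equation can be read backwards: its modulus gives `x = |1 - 2 η
ζ| / 2`, its phase gives `e`. -/
theorem exists_direction_of_mem_supportArc {η ζ : ℂ} {t : ℝ} (ht : 0 < t)
    (h : ζ ∈ supportArc η t) : ∃ e x, ‖e‖ = 1 ∧ t ≤ x ∧
      2 * (x : ℝ) * ζ = e * (1 - 2 * conj η * conj ζ) ∧ IsSupport η t e ζ := by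
  obtain ⟨hζ, h⟩ := h
  have h3 : ‖1 - 2 * conj η * conj ζ‖ = ‖1 - 2 * η * ζ‖ := by
    rw [← Complex.norm_conj (1 - 2 * η * ζ)]
    simp only [map_sub, map_mul, map_one, map_ofNat]
  have h4 : 0 < ‖1 - 2 * conj η * conj ζ‖ := by rw [h3]; linarith
  have h0 := norm_pos_iff.1 h4
  set x : ℝ := ‖1 - 2 * conj η * conj ζ‖ / 2 with hx
  have htx : t ≤ x := by rw [hx, h3]; linarith
  have he : 2 * (x : ℂ) * ζ = 2 * x * ζ / (1 - 2 * conj η * conj ζ) *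
      (1 - 2 * conj η * conj ζ) := (div_mul_cancel₀ _ h0).symm
  refine ⟨2 * x * ζ / (1 - 2 * conj η * conj ζ), x, ?_, htx, he, hζ.le, x, htx, he, Or.inr hζ⟩
  rw [norm_div, norm_mul, norm_mul, hζ, norm_real, Real.norm_of_nonneg (by positivity), hx]
  norm_num
  rw [mul_div_cancel₀ _ two_ne_zero, div_self h4.ne']

/-- If two values agree, `ζ'` attains the maximum in the direction belonging to `ζ`, and the
maximizer is unique. -/
theorem injOn_supportArc {η : ℂ} {t : ℝ} (ht : ‖η‖ < t) :
    InjOn (fun ζ => ζ * (1 - η * ζ)) (supportArc η t) := by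
  intro ζ hζ ζ' hζ' heq
  obtain ⟨e, -, he, -, -, hs⟩ :=
    exists_direction_of_mem_supportArc ((norm_nonneg η).trans_lt ht) hζ
  refine (hs.eq_of_le ht he hζ'.1.le ?_).symm
  rw [re_conj_mul_supportPoint he, hζ.1, hζ'.1]
  simp only at heq
  rw [heq]

theorem exists_angle {e : ℂ} (he : ‖e‖ = 1) :
    ∃ θ : ℝ, θ ∈ Ioc (-Real.pi) Real.pi ∧ exp (θ * I) = e := by
  refine ⟨arg e, ⟨neg_pi_lt_arg e, arg_le_pi e⟩, ?_⟩
  have := norm_mul_exp_arg_mul_I e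
  simpa [he] using this

theorem frontier_diskUnion_eq_image_zetaTheta {η : ℂ} {t : ℝ} (ht : ‖η‖ < t) :
    frontier (diskUnion η t) =
      (fun θ : ℝ => supportPoint η t (exp (θ * I)) (zetaTheta t η θ)) ''
        Ioc (-Real.pi) Real.pi := by
  have harg : ∀ e : ℂ, ‖e‖ = 1 → exp (arg e * I) = e := fun e he => by
    simpa [he] using norm_mul_exp_arg_mul_I e
  have hZ : ∀ e : ℂ, ‖e‖ = 1 → IsSupport η t e (zetaTheta t η (arg e)) := fun e he => by
    have := isSupport_zetaTheta ht (arg e)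
    rwa [harg e he] at this
  rw [frontier_diskUnion ht hZ]
  ext w
  constructor
  · rintro ⟨e, he, rfl⟩
    rw [mem_sphere_zero_iff_norm] at he
    exact ⟨arg e, ⟨neg_pi_lt_arg e, arg_le_pi e⟩, by simp only [harg e he]⟩
  · rintro ⟨θ, hθ, rfl⟩
    refine ⟨exp (θ * I), by simp, ?_⟩
    simp only
    rw [(hZ _ (norm_exp_mul_I θ)).unique ht (norm_exp_mul_I θ) (isSupport_zetaTheta ht θ)]

theorem supportPoint_mem_frontier {η e ζ : ℂ} {t : ℝ} (ht : ‖η‖ < t) (he : ‖e‖ = 1)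
    (h : IsSupport η t e ζ) : supportPoint η t e ζ ∈ frontier (diskUnion η t) := by
  obtain ⟨θ, hθ, rfl⟩ := exists_angle he
  rw [frontier_diskUnion_eq_image_zetaTheta ht]
  exact ⟨θ, hθ, by simp only [h.unique ht he (isSupport_zetaTheta ht θ)]⟩

/-- The frontier consists of a part of a circle and of the image of `supportArc η t`. -/
theorem frontier_diskUnion_eq_union {η : ℂ} {t : ℝ} (ht : ‖η‖ < t) :
    frontier (diskUnion η t) =
      (fun θ : ℝ => supportPoint η t (exp (θ * I)) (critical η t (exp (θ * I)))) ''
        {θ | θ ∈ Ioc (-Real.pi) Real.pi ∧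
          ‖(t : ℂ) * exp (θ * I) - conj η‖ < 2 * (t ^ 2 - ‖η‖ ^ 2)} ∪
      (fun ζ => ζ * (1 - η * ζ)) '' supportArc η t := by
  apply Subset.antisymm
  · rw [frontier_diskUnion_eq_image_zetaTheta ht]
    rintro _ ⟨θ, hθ, rfl⟩
    have hs := isSupport_zetaTheta ht θ
    rcases lt_or_ge ‖(t : ℂ) * exp (θ * I) - conj η‖ (2 * (t ^ 2 - ‖η‖ ^ 2)) with h | h
    · refine Or.inl ⟨θ, ⟨hθ, h⟩, ?_⟩
      simp only
      rw [hs.unique ht (norm_exp_mul_I θ) (isSupport_critical_of_le ht (norm_exp_mul_I θ) h.le)]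
    · have h1 := norm_zetaTheta_of_le ht h
      exact Or.inr ⟨_, hs.mem_supportArc (norm_exp_mul_I θ) h1,
        (supportPoint_of_norm_eq_one h1).symm⟩
  · rintro _ (⟨θ, ⟨-, h⟩, rfl⟩ | ⟨ζ, hζ, rfl⟩)
    · exact supportPoint_mem_frontier ht (norm_exp_mul_I θ)
        (isSupport_critical_of_le ht (norm_exp_mul_I θ) h.le)
    · obtain ⟨e, -, he, -, -, hs⟩ :=
        exists_direction_of_mem_supportArc ((norm_nonneg η).trans_lt ht) hζ
      have := supportPoint_mem_frontier ht he hs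
      rwa [supportPoint_of_norm_eq_one hζ.1] at this

/-! ### Angular description of the two arcs -/

theorem re_exp_mul_eq (η : ℂ) (θ : ℝ) :
    (exp (θ * I) * η).re = ‖η‖ * Real.cos (θ + arg η) := by
  have h : exp (θ * I) * η = (‖η‖ : ℂ) * exp (((θ + arg η : ℝ) : ℂ) * I) := by
    conv_lhs => rw [← norm_mul_exp_arg_mul_I η]
    push_cast
    rw [add_mul, exp_add]
    ring
  rw [h, re_ofReal_mul, exp_ofReal_mul_I_re]

theorem sq_norm_mul_exp_sub_conj (η : ℂ) (t θ : ℝ) :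
    ‖(t : ℂ) * exp (θ * I) - conj η‖ ^ 2 =
      t ^ 2 + ‖η‖ ^ 2 - 2 * t * ‖η‖ * Real.cos (θ + arg η) := by
  have h1 := re_exp_mul_eq η θ
  have h2 : ‖(t : ℂ) * exp (θ * I) - conj η‖ ^ 2 =
      t ^ 2 * ‖exp (θ * I)‖ ^ 2 + ‖η‖ ^ 2 - 2 * t * (exp (θ * I) * η).re := by
    generalize exp (θ * I) = e
    simp only [Complex.sq_norm, Complex.normSq_apply, mul_re, mul_im, sub_re, sub_im, conj_re,
      conj_im, ofReal_re, ofReal_im]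
    ring
  rw [h2, h1, norm_exp_mul_I]
  ring

/-- The threshold comes from squaring the norm inequality and applying the law of cosines. -/
theorem threshold_lt_cos_iff {η : ℂ} {t θ : ℝ} (ht : ‖η‖ < t) (hη : η ≠ 0) :
    threshold t η < Real.cos (θ + arg η) ↔
      ‖(t : ℂ) * exp (θ * I) - conj η‖ < 2 * (t ^ 2 - ‖η‖ ^ 2) := by
  have hη0 : 0 < ‖η‖ := norm_pos_iff.2 hη
  have h0 := sq_sub_sq_norm_pos ht
  have ht0 : 0 < t := hη0.trans ht
  rw [← pow_lt_pow_iff_left₀ (norm_nonneg _) (by positivity) two_ne_zero,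
    sq_norm_mul_exp_sub_conj, threshold, div_lt_iff₀ (by positivity)]
  constructor <;> intro h <;> linarith

/-- It replaces the implicit numbers `t_θ` by one explicit inequality on `ζ`, from which the arc
property and injectivity follow. -/
theorem setJ_eq_supportArc {η : ℂ} {t : ℝ} (ht : ‖η‖ < t) (hη : η ≠ 0) :
    setJ t η = supportArc η t := by
  have ht0 : 0 < t := (norm_nonneg η).trans_lt ht
  ext ζ
  constructor
  · rintro ⟨θ, hθ, rfl⟩
    have h := not_lt.1 fun h => not_lt.2 hθ ((threshold_lt_cos_iff ht hη).2 h)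
    exact (isSupport_zetaTheta ht θ).mem_supportArc (norm_exp_mul_I θ) (norm_zetaTheta_of_le ht h)
  · intro hζ
    obtain ⟨e, -, he, -, -, hs⟩ := exists_direction_of_mem_supportArc ht0 hζ
    obtain ⟨θ, -, rfl⟩ := exists_angle he
    refine ⟨θ, not_lt.1 fun h => ?_, hs.unique ht he (isSupport_zetaTheta ht θ)⟩
    rw [threshold_lt_cos_iff ht hη] at h
    have h1 := hs.unique ht he (isSupport_critical_of_le ht he h.le)
    have h2 := hζ.1
    have h0 := sq_sub_sq_norm_pos ht
    rw [h1, norm_critical ht, div_eq_one_iff_eq (by positivity)] at h2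
    exact h.ne h2

theorem exists_principal_angle (θ : ℝ) :
    ∃ ψ : ℝ, ψ ∈ Ioc (-Real.pi) Real.pi ∧ exp (ψ * I) = exp (θ * I) ∧ Real.cos ψ = Real.cos θ := by
  obtain ⟨ψ, hψ, h⟩ := exists_angle (norm_exp_mul_I θ)
  refine ⟨ψ, hψ, h, ?_⟩
  rw [← exp_ofReal_mul_I_re, h, exp_ofReal_mul_I_re]

theorem arccos_cos_eq_abs {ψ : ℝ} (h : ψ ∈ Ioc (-Real.pi) Real.pi) :
    Real.arccos (Real.cos ψ) = |ψ| := by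
  rw [← Real.cos_abs, Real.arccos_cos (abs_nonneg _) (abs_le.2 ⟨h.1.le, h.2⟩)]

theorem exp_sub_mul_I_congr {ψ θ δ : ℝ} (h : exp (ψ * I) = exp (((θ + δ : ℝ) : ℂ) * I)) :
    exp (((ψ - δ : ℝ) : ℂ) * I) = exp (θ * I) := by
  push_cast at h ⊢
  rw [sub_mul, exp_sub, h, add_mul, exp_add, mul_div_cancel_right₀ _ (exp_ne_zero _)]

theorem isClosedUnitArc_image_exp {m δ : ℝ} (h1 : -1 < m) (h2 : m < 1) :
    IsClosedUnitArc ((fun θ : ℝ => exp (θ * I)) '' {θ | Real.cos (θ + δ) ≤ m}) := by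
  have ha : Real.arccos m < Real.pi := by
    refine lt_of_le_of_ne (Real.arccos_le_pi m) fun h => ?_
    rw [Real.arccos_eq_pi] at h
    linarith
  have hb : 0 < Real.arccos m := Real.arccos_pos.2 h2
  -- Shifted by `δ`, the angles with cosine at most `m` in one period starting at `0` are those from
  -- `arccos m` to `2π - arccos m`.
  refine ⟨Real.arccos m - δ, 2 * Real.pi - Real.arccos m - δ, by linarith, by linarith, ?_⟩
  apply Subset.antisymm
  · rintro _ ⟨θ, hθ, rfl⟩
    obtain ⟨ψ, hψ, he, hc⟩ := exists_principal_angle (θ + δ)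
    have h3 : Real.arccos m ≤ |ψ| := by
      rw [← arccos_cos_eq_abs hψ, hc]
      exact Real.arccos_le_arccos hθ
    rcases le_total 0 ψ with h | h
    · rw [abs_of_nonneg h] at h3
      exact ⟨ψ - δ, ⟨by linarith, by linarith [hψ.2]⟩, exp_sub_mul_I_congr he⟩
    · rw [abs_of_nonpos h] at h3
      refine ⟨ψ + 2 * Real.pi - δ, ⟨by linarith [hψ.1], by linarith⟩, exp_sub_mul_I_congr ?_⟩
      rw [← he]
      push_cast
      rw [add_mul, exp_add, exp_two_pi_mul_I, mul_one]
  · rintro _ ⟨θ, hθ, rfl⟩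
    refine ⟨θ, ?_, rfl⟩
    have hm := Real.cos_arccos h1.le h2.le
    change Real.cos (θ + δ) ≤ m
    rcases le_total (θ + δ) Real.pi with h | h
    · rw [← hm]
      exact Real.cos_le_cos_of_nonneg_of_le_pi hb.le h (by linarith [hθ.1])
    · rw [← hm, ← Real.cos_two_pi_sub (θ + δ)]
      exact Real.cos_le_cos_of_nonneg_of_le_pi hb.le (by linarith) (by linarith [hθ.2])

theorem isOpenCircularArc_image {z K : ℂ} {κ δ : ℝ} (hK : K ≠ 0) (h1 : -1 < κ) (h2 : κ < 1) :
    IsOpenCircularArc ((fun θ : ℝ => z + K * exp (θ * I)) ''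
      {θ | θ ∈ Ioc (-Real.pi) Real.pi ∧ κ < Real.cos (θ + δ)}) := by
  have ha : Real.arccos κ < Real.pi := by
    refine lt_of_le_of_ne (Real.arccos_le_pi κ) fun h => ?_
    rw [Real.arccos_eq_pi] at h
    linarith
  have hb : 0 < Real.arccos κ := Real.arccos_pos.2 h2
  have hm := Real.cos_arccos h1.le h2.le
  have hKe : ∀ θ : ℝ, (‖K‖ : ℂ) * exp (((θ + arg K : ℝ) : ℂ) * I) = K * exp (θ * I) := by
    intro θ
    conv_rhs => rw [← norm_mul_exp_arg_mul_I K]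
    push_cast
    rw [add_mul, exp_add]
    ring
  -- The arc `|θ + δ| < arccos κ`, turned by the argument of `K`.
  refine ⟨z, ‖K‖, -Real.arccos κ - δ + arg K, Real.arccos κ - δ + arg K, norm_pos_iff.2 hK,
    by linarith, by linarith, ?_⟩
  apply Subset.antisymm
  · rintro _ ⟨θ, ⟨-, hθ⟩, rfl⟩
    obtain ⟨ψ, hψ, he, hc⟩ := exists_principal_angle (θ + δ)
    have h3 : |ψ| < Real.arccos κ := by
      rw [← arccos_cos_eq_abs hψ, hc]
      exact Real.strictAntiOn_arccos ⟨h1.le, h2.le⟩ ⟨Real.neg_one_le_cos _, Real.cos_le_one _⟩ hθ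
    obtain ⟨h4, h5⟩ := abs_lt.1 h3
    refine ⟨ψ - δ + arg K, ⟨by linarith, by linarith⟩, ?_⟩
    simp only [hKe, exp_sub_mul_I_congr he]
  · rintro _ ⟨θ, hθ, rfl⟩
    obtain ⟨ψ, hψ, he, -⟩ := exists_principal_angle (θ - arg K)
    refine ⟨ψ, ⟨hψ, ?_⟩, ?_⟩
    · have h3 : Real.cos (ψ + δ) = Real.cos (θ - arg K + δ) := by
        rw [← exp_ofReal_mul_I_re, ← exp_ofReal_mul_I_re]
        push_cast at he ⊢
        rw [add_mul, exp_add, he, ← exp_add, ← add_mul]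
      rw [h3, ← Real.cos_abs, ← hm]
      refine Real.cos_lt_cos_of_nonneg_of_le_pi (abs_nonneg _) ha.le (abs_lt.2 ⟨?_, ?_⟩)
      · linarith [hθ.1]
      · linarith [hθ.2]
    · simp only [he, ← hKe, sub_add_cancel]

theorem isClosedUnitArc_supportArc {η : ℂ} {t : ℝ} (ht : ‖η‖ < t) (hη : η ≠ 0)
    (h1 : 1 / 2 < t + ‖η‖) (h2 : t - ‖η‖ < 1 / 2) : IsClosedUnitArc (supportArc η t) := by
  have hη0 : 0 < ‖η‖ := norm_pos_iff.2 hη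
  have ht0 : 0 < t := hη0.trans ht
  -- From `|1 - 2 η ζ|² = 1 + 4 |η|² - 4 |η| cos (θ + arg η) ≥ 4 t²`. Here `θ` is the angle of `ζ`,
  -- not of the direction `e`, so `m` is not the threshold.
  set m : ℝ := (1 + 4 * ‖η‖ ^ 2 - 4 * t ^ 2) / (4 * ‖η‖) with hm
  have hm1 : -1 < m := by
    rw [hm, lt_div_iff₀ (by positivity)]
    nlinarith
  have hm2 : m < 1 := by
    rw [hm, div_lt_one (by positivity)]
    nlinarith
  have hiff : ∀ θ : ℝ, Real.cos (θ + arg η) ≤ m ↔ 2 * t ≤ ‖1 - 2 * η * exp (θ * I)‖ := by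
    intro θ
    have h3 : ‖1 - 2 * η * exp (θ * I)‖ ^ 2 =
        1 + 4 * ‖η‖ ^ 2 * ‖exp (θ * I)‖ ^ 2 - 4 * (exp (θ * I) * η).re := by
      generalize exp (θ * I) = e
      simp only [Complex.sq_norm, Complex.normSq_apply, mul_re, mul_im, sub_re, sub_im, one_re,
        one_im, re_ofNat, im_ofNat]
      ring
    rw [re_exp_mul_eq, norm_exp_mul_I] at h3
    rw [← pow_le_pow_iff_left₀ (by positivity) (norm_nonneg _) two_ne_zero, h3, hm,
      le_div_iff₀ (by positivity)]
    constructor <;> intro h <;> linarith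
  have : supportArc η t = (fun θ : ℝ => exp (θ * I)) '' {θ | Real.cos (θ + arg η) ≤ m} := by
    ext ζ
    constructor
    · rintro ⟨hζ, h⟩
      obtain ⟨θ, -, rfl⟩ := exists_angle hζ
      exact ⟨θ, (hiff θ).2 h, rfl⟩
    · rintro ⟨θ, hθ, rfl⟩
      exact ⟨norm_exp_mul_I θ, (hiff θ).1 hθ⟩
  rw [this]
  exact isClosedUnitArc_image_exp hm1 hm2

/-- The bounds say `2 (t² - |η|²) < t + |η|` and `t - |η| < 2 (t² - |η|²)`; cancelling the common
factors leaves the two hypotheses. -/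
theorem threshold_mem_Ioo {η : ℂ} {t : ℝ} (ht : ‖η‖ < t) (hη : η ≠ 0)
    (h1 : 1 / 2 < t + ‖η‖) (h2 : t - ‖η‖ < 1 / 2) : threshold t η ∈ Ioo (-1) 1 := by
  have hη0 : 0 < ‖η‖ := norm_pos_iff.2 hη
  have ht0 : 0 < t := hη0.trans ht
  have h3 : 0 < t - ‖η‖ := sub_pos.2 ht
  constructor
  · rw [threshold, lt_div_iff₀ (by positivity)]
    have h4 : 2 * (t - ‖η‖) * (t + ‖η‖) < t + ‖η‖ := by nlinarith
    have h5 : (2 * (t - ‖η‖) * (t + ‖η‖)) ^ 2 < (t + ‖η‖) ^ 2 :=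
      pow_lt_pow_left₀ h4 (by positivity) two_ne_zero
    linarith
  · rw [threshold, div_lt_one (by positivity)]
    have h4 : t - ‖η‖ < 2 * (t - ‖η‖) * (t + ‖η‖) := by nlinarith
    have h5 : (t - ‖η‖) ^ 2 < (2 * (t - ‖η‖) * (t + ‖η‖)) ^ 2 :=
      pow_lt_pow_left₀ h4 h3.le two_ne_zero
    linarith

/-! ### Transfer to the variability region -/

theorem frontier_image_affine {a b c : ℂ} (h : a * c ≠ 0) (S : Set ℂ) :
    frontier ((fun w => a * (b + c * w)) '' S) = (fun w => a * (b + c * w)) '' frontier S := by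
  have h1 : (fun w => a * (b + c * w)) =
      (Homeomorph.mulLeft₀ (a * c) h).trans (Homeomorph.addRight (a * b)) := by
    funext w
    simp
    ring
  rw [h1, ← Homeomorph.image_frontier]

theorem circleMap_eq_affine (r s : ℝ) (lam : ℂ) : ∃ z, ∀ ω, circleMap r s lam ω =
    z + ((coefA r s : ℂ) * coefC r s lam) *
      ((1 + 4 * ((tPar r s lam : ℂ) ^ 2 - (‖eta r s lam‖ : ℂ) ^ 2)) * tPar r s lam /
        (4 * ((tPar r s lam : ℂ) ^ 2 - (‖eta r s lam‖ : ℂ) ^ 2))) * ω :=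
  ⟨(coefA r s : ℂ) * (coefB r s lam - conj (eta r s lam) /
    (4 * ((tPar r s lam : ℂ) ^ 2 - (‖eta r s lam‖ : ℂ) ^ 2)) * coefC r s lam), fun ω => by
    rw [circleMap]; ring⟩

theorem circleMap_eq_add_mul {r s : ℝ} {lam : ℂ} (hs : 0 ≤ s) (hsr : s < r) (hr : r < 1)
    (hlam : ‖lam‖ < 1) : ∃ z K, K ≠ 0 ∧ ∀ ω, circleMap r s lam ω = z + K * ω := by
  obtain ⟨z, hz⟩ := circleMap_eq_affine r s lam
  have ht := norm_eta_lt_tPar hs hsr hr hlam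
  refine ⟨z, _, mul_ne_zero (coefA_mul_coefC_ne_zero hs hsr hr hlam)
    (div_ne_zero (mul_ne_zero ?_ ?_) (mul_ne_zero (by norm_num) (sq_sub_sq_norm_ne_zero ht))), hz⟩
  · have : 1 + 4 * (tPar r s lam ^ 2 - ‖eta r s lam‖ ^ 2) ≠ 0 := by
      have := sq_sub_sq_norm_pos ht
      positivity
    exact_mod_cast this
  · exact_mod_cast (tPar_pos hs hsr hr hlam).ne'

theorem circleMap_eq_supportPoint {r s : ℝ} {lam ω : ℂ} (hs : 0 ≤ s) (hsr : s < r) (hr : r < 1)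
    (hlam : ‖lam‖ < 1) (hω : ‖ω‖ = 1) :
    circleMap r s lam ω = coefA r s * (coefB r s lam + coefC r s lam *
      supportPoint (eta r s lam) (tPar r s lam) ω (critical (eta r s lam) (tPar r s lam) ω)) := by
  rw [supportPoint_critical (norm_eta_lt_tPar hs hsr hr hlam) hω, circleMap]
  ring

theorem frontier_region {r s : ℝ} {lam : ℂ} (hs : 0 ≤ s) (hsr : s < r) (hr : r < 1)
    (hlam : ‖lam‖ < 1) :
    frontier (region r s lam) = (fun w => (coefA r s : ℂ) * (coefB r s lam + coefC r s lam * w)) ''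
      frontier (diskUnion (eta r s lam) (tPar r s lam)) := by
  rw [region_eq_image_diskUnion hs hsr hr hlam,
    frontier_image_affine (coefA_mul_coefC_ne_zero hs hsr hr hlam)]

theorem curve_image (r s : ℝ) (lam : ℂ) (S : Set ℂ) :
    curve r s lam '' S = (fun w => (coefA r s : ℂ) * (coefB r s lam + coefC r s lam * w)) ''
      ((fun ζ => ζ * (1 - eta r s lam * ζ)) '' S) := by
  rw [image_image]; rfl

theorem continuous_curve (r s : ℝ) (lam : ℂ) : Continuous (curve r s lam) := by
  unfold curve; fun_prop

theorem injOn_curve {r s : ℝ} {lam : ℂ} (hs : 0 ≤ s) (hsr : s < r) (hr : r < 1)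
    (hlam : ‖lam‖ < 1) :
    InjOn (curve r s lam) (supportArc (eta r s lam) (tPar r s lam)) := by
  intro ζ hζ ζ' hζ' h
  have h0 := coefA_mul_coefC_ne_zero hs hsr hr hlam
  refine injOn_supportArc (norm_eta_lt_tPar hs hsr hr hlam) hζ hζ' ?_
  simp only [curve] at h
  have h1 := mul_left_cancel₀ (left_ne_zero_of_mul h0) h
  exact mul_left_cancel₀ (right_ne_zero_of_mul h0) (add_left_cancel h1)

theorem frontier_region_eq_union {r s : ℝ} {lam : ℂ} (hs : 0 ≤ s) (hsr : s < r) (hr : r < 1)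
    (hlam : ‖lam‖ < 1) :
    frontier (region r s lam) =
      (fun θ : ℝ => circleMap r s lam (exp (θ * I))) ''
        {θ | θ ∈ Ioc (-Real.pi) Real.pi ∧
          ‖(tPar r s lam : ℂ) * exp (θ * I) - conj (eta r s lam)‖ <
            2 * (tPar r s lam ^ 2 - ‖eta r s lam‖ ^ 2)} ∪
      curve r s lam '' supportArc (eta r s lam) (tPar r s lam) := by
  rw [frontier_region hs hsr hr hlam,
    frontier_diskUnion_eq_union (norm_eta_lt_tPar hs hsr hr hlam), image_union, image_image,
    curve_image]
  congr 2
  funext θ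
  rw [circleMap_eq_supportPoint hs hsr hr hlam (norm_exp_mul_I θ)]

theorem norm_mul_sub_conj_le {η e : ℂ} {t : ℝ} (ht : 0 ≤ t) (he : ‖e‖ = 1) :
    ‖(t : ℂ) * e - conj η‖ ≤ t + ‖η‖ := by
  refine (norm_sub_le _ _).trans ?_
  rw [norm_mul, he, norm_real, Complex.norm_conj, mul_one, Real.norm_of_nonneg ht]

theorem supportArc_eq_sphere {η : ℂ} {t : ℝ} (h : t + ‖η‖ ≤ 1 / 2) :
    supportArc η t = sphere 0 1 := by
  ext ζ
  rw [mem_sphere_zero_iff_norm]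
  refine ⟨fun h => h.1, fun hζ => ⟨hζ, ?_⟩⟩
  have h1 := norm_sub_norm_le (1 : ℂ) (2 * η * ζ)
  rw [norm_mul, norm_mul, hζ] at h1
  norm_num at h1
  linarith

theorem frontier_region_eq_curve {r s : ℝ} {lam : ℂ} (hs : 0 ≤ s) (hsr : s < r) (hr : r < 1)
    (hlam : ‖lam‖ < 1) (h : tPar r s lam + ‖eta r s lam‖ ≤ 1 / 2) :
    frontier (region r s lam) = curve r s lam '' sphere 0 1 := by
  rw [frontier_region_eq_union hs hsr hr hlam, supportArc_eq_sphere h]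
  have ht := norm_eta_lt_tPar hs hsr hr hlam
  -- No direction has an inactive constraint: `|t e - conj η| ≥ t - |η| ≥ 2 (t² - |η|²)`.
  convert empty_union _
  rw [image_eq_empty, eq_empty_iff_forall_notMem]
  rintro θ ⟨-, hθ⟩
  have h1 := norm_sub_norm_le ((tPar r s lam : ℂ) * exp (θ * I)) (conj (eta r s lam))
  rw [norm_mul, norm_exp_mul_I, norm_real, Complex.norm_conj, mul_one,
    Real.norm_of_nonneg (tPar_pos hs hsr hr hlam).le] at h1
  nlinarith

theorem frontier_region_eq_circleMap {r s : ℝ} {lam : ℂ} (hs : 0 ≤ s) (hsr : s < r) (hr : r < 1)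
    (hlam : ‖lam‖ < 1) (h : 1 / 2 ≤ tPar r s lam - ‖eta r s lam‖) :
    frontier (region r s lam) = circleMap r s lam '' sphere 0 1 := by
  have ht := norm_eta_lt_tPar hs hsr hr hlam
  have ht0 := tPar_pos hs hsr hr hlam
  -- Here `|t e - conj η| ≤ t + |η| ≤ 2 (t² - |η|²)` for all `e`. Using the critical points directly
  -- also covers directions with equality, which the strict inequality in `frontier_region_eq_union`
  -- excludes from its circular part.
  rw [frontier_region hs hsr hr hlam, frontier_diskUnion ht (fun e he =>
    isSupport_critical_of_le ht he ((norm_mul_sub_conj_le ht0.le he).trans ?_)), image_image]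
  · refine image_congr fun ω hω => ?_
    rw [circleMap_eq_supportPoint hs hsr hr hlam (by simpa using hω)]
  · nlinarith [norm_nonneg (eta r s lam)]

theorem image_sphere_eq_sphere {z K : ℂ} (hK : K ≠ 0) :
    (fun ω => z + K * ω) '' sphere 0 1 = sphere z ‖K‖ := by
  ext w
  constructor
  · rintro ⟨ω, hω, rfl⟩
    rw [mem_sphere_zero_iff_norm] at hω
    simp [hω]
  · intro hw
    rw [mem_sphere_iff_norm] at hw
    refine ⟨(w - z) / K, ?_, ?_⟩
    · rw [mem_sphere_zero_iff_norm, norm_div, hw, div_self (norm_ne_zero_iff.2 hK)]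
    · simp only [mul_div_cancel₀ _ hK, add_sub_cancel]

theorem injOn_exp_mul_I : InjOn (fun θ : ℝ => exp (θ * I)) (Ioc (-Real.pi) Real.pi) := by
  intro θ hθ θ' hθ' h
  have h1 := congrArg log h
  simp only at h1
  rw [log_exp (by simpa using hθ.1) (by simpa using hθ.2), log_exp (by simpa using hθ'.1)
    (by simpa using hθ'.2)] at h1
  exact_mod_cast mul_right_cancel₀ I_ne_zero h1

end ThirdDieudonne

end

theorem theorem4p2 (r s : ℝ) (lam : ℂ) (hs : 0 ≤ s) (hsr : s < r) (hr : r < 1)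
    (hlam : ‖lam‖ < 1) :
    -- case (i): a Jordan curve
    (ThirdDieudonne.tPar r s lam + ‖ThirdDieudonne.eta r s lam‖ ≤ 1 / 2 →
      frontier (ThirdDieudonne.region r s lam) =
          ThirdDieudonne.curve r s lam '' sphere (0 : ℂ) 1 ∧
        ContinuousOn (ThirdDieudonne.curve r s lam) (sphere (0 : ℂ) 1) ∧
        InjOn (ThirdDieudonne.curve r s lam) (sphere (0 : ℂ) 1)) ∧
    -- case (ii): a circle
    (1 / 2 ≤ ThirdDieudonne.tPar r s lam - ‖ThirdDieudonne.eta r s lam‖ →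
      frontier (ThirdDieudonne.region r s lam) =
          ThirdDieudonne.circleMap r s lam '' sphere (0 : ℂ) 1 ∧
        InjOn (ThirdDieudonne.circleMap r s lam) (sphere (0 : ℂ) 1) ∧
        ThirdDieudonne.IsCircle (frontier (ThirdDieudonne.region r s lam))) ∧
    -- case (iii): a circular arc together with a simple arc
    (1 / 2 < ThirdDieudonne.tPar r s lam + ‖ThirdDieudonne.eta r s lam‖ →
      ThirdDieudonne.tPar r s lam - ‖ThirdDieudonne.eta r s lam‖ < 1 / 2 →
      -- the number `t_θ` entering `J` is well defined
      (∀ θ : ℝ, 2 * (ThirdDieudonne.tPar r s lam ^ 2 - ‖ThirdDieudonne.eta r s lam‖ ^ 2) ≤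
            ‖(ThirdDieudonne.tPar r s lam : ℂ) * exp (θ * I) -
              (starRingEnd ℂ) (ThirdDieudonne.eta r s lam)‖ →
          ∃! x : ℝ, ThirdDieudonne.IsSol (ThirdDieudonne.eta r s lam) θ x) ∧
        frontier (ThirdDieudonne.region r s lam) =
          (fun θ : ℝ => ThirdDieudonne.circleMap r s lam (exp (θ * I))) ''
              ThirdDieudonne.setTheta (ThirdDieudonne.tPar r s lam)
                (ThirdDieudonne.eta r s lam) ∪
            ThirdDieudonne.curve r s lam ''
              ThirdDieudonne.setJ (ThirdDieudonne.tPar r s lam)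
                (ThirdDieudonne.eta r s lam) ∧
        -- the first part is a circular arc, parametrized by `Θ`
        InjOn (fun θ : ℝ => ThirdDieudonne.circleMap r s lam (exp (θ * I)))
          (ThirdDieudonne.setTheta (ThirdDieudonne.tPar r s lam)
            (ThirdDieudonne.eta r s lam)) ∧
        ThirdDieudonne.IsOpenCircularArc
          ((fun θ : ℝ => ThirdDieudonne.circleMap r s lam (exp (θ * I))) ''
            ThirdDieudonne.setTheta (ThirdDieudonne.tPar r s lam)
              (ThirdDieudonne.eta r s lam)) ∧
        -- `J` is a closed subarc of the unit circle, and the second part is a simple arc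
        ThirdDieudonne.IsClosedUnitArc
          (ThirdDieudonne.setJ (ThirdDieudonne.tPar r s lam)
            (ThirdDieudonne.eta r s lam)) ∧
        ContinuousOn (ThirdDieudonne.curve r s lam)
          (ThirdDieudonne.setJ (ThirdDieudonne.tPar r s lam)
            (ThirdDieudonne.eta r s lam)) ∧
        InjOn (ThirdDieudonne.curve r s lam)
          (ThirdDieudonne.setJ (ThirdDieudonne.tPar r s lam)
            (ThirdDieudonne.eta r s lam))) := by
  have ht := ThirdDieudonne.norm_eta_lt_tPar hs hsr hr hlam
  have ht0 := ThirdDieudonne.tPar_pos hs hsr hr hlam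
  have hcont : Continuous (ThirdDieudonne.curve r s lam) :=
    ThirdDieudonne.continuous_curve r s lam
  have hinj := ThirdDieudonne.injOn_curve hs hsr hr hlam
  obtain ⟨z, K, hK, hcirc⟩ := ThirdDieudonne.circleMap_eq_add_mul hs hsr hr hlam
  have hcinj : Function.Injective (ThirdDieudonne.circleMap r s lam) := fun ω ω' h => by
    rw [hcirc, hcirc] at h
    exact mul_left_cancel₀ hK (add_left_cancel h)
  refine ⟨fun h => ?_, fun h => ?_, fun h1 h2 => ?_⟩
  · rw [ThirdDieudonne.supportArc_eq_sphere h] at hinj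
    exact ⟨ThirdDieudonne.frontier_region_eq_curve hs hsr hr hlam h, hcont.continuousOn, hinj⟩
  · refine ⟨ThirdDieudonne.frontier_region_eq_circleMap hs hsr hr hlam h, hcinj.injOn,
      z, ‖K‖, norm_pos_iff.2 hK, ?_⟩
    rw [ThirdDieudonne.frontier_region_eq_circleMap hs hsr hr hlam h, funext hcirc,
      ThirdDieudonne.image_sphere_eq_sphere hK]
  -- For `η = 0` the hypotheses would read `t > 1/2` and `t < 1/2`; so the division by `|η|` in the
  -- threshold is genuine.
  · have hη : ThirdDieudonne.eta r s lam ≠ 0 := by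
      intro h
      rw [h, norm_zero] at h1 h2
      linarith
    have hΘ : ThirdDieudonne.setTheta (ThirdDieudonne.tPar r s lam) (ThirdDieudonne.eta r s lam) =
        {θ | θ ∈ Ioc (-Real.pi) Real.pi ∧
          ‖(ThirdDieudonne.tPar r s lam : ℂ) * exp (θ * I) -
            (starRingEnd ℂ) (ThirdDieudonne.eta r s lam)‖ <
              2 * (ThirdDieudonne.tPar r s lam ^ 2 - ‖ThirdDieudonne.eta r s lam‖ ^ 2)} := by
      ext θ
      exact and_congr_right fun _ => ThirdDieudonne.threshold_lt_cos_iff ht hη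
    have hκ := ThirdDieudonne.threshold_mem_Ioo ht hη h1 h2
    rw [ThirdDieudonne.setJ_eq_supportArc ht hη]
    refine ⟨fun θ h => ThirdDieudonne.existsUnique_isSol ht h, ?_, ?_, ?_,
      ThirdDieudonne.isClosedUnitArc_supportArc ht hη h1 h2, hcont.continuousOn, hinj⟩
    · rw [hΘ, ThirdDieudonne.frontier_region_eq_union hs hsr hr hlam]
    · intro θ hθ θ' hθ' h
      exact ThirdDieudonne.injOn_exp_mul_I hθ.1 hθ'.1 (hcinj h)
    · simp only [hcirc]
      exact ThirdDieudonne.isOpenCircularArc_image hK hκ.1 hκ.2
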